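/- Let $K$ be a field. For a finite simple graph $G$, let $J_G = (x_iy_j - x_jy_i : \{i,j\} \in E(G)) \subset K[x_i,y_i : i \in V(G)]$ be its binomial edge ideal. An ideal is unmixed if all its minimal primes have the same height. For $S \subseteq V(G)$ let $c_G(S)$ be the number of connected components of the subgraph of $G$ induced on $V(G)\setminus S$, and let $\mathcal M(G)$ be the set of cut sets of $G$, that is, of the $S \subseteq V(G)$ such that $S = \emptyset$, or $S \neq \emptyset$ and $c_G(S\setminus\{i\}) < c_G(S)$ for every $i \in S$. A leaf is a vertex of degree $1$. Let $H$ be a finite connected bipartite graph with bipartition $V(H) = V_1 \sqcup V_2$ and $|V_1| = |V_2|$. Let $v$ and $f$ be two new vertices and let $G$ be the graph with $V(G) = V(H) \cup \{v,f\}$ and $E(G) = E(H) \cup \{\{v,x\} : x \in V_1 \cup \{f\}\}$. (a) If $J_H$ is unmixed and the neighbours of the leaves of $H$ are adjacent (that is, for any two distinct leaves of $H$, the neighbour of one is adjacent to the neighbour of the other), then $J_G$ is unmixed and $$\mathcal M(G) = \{\emptyset, V_1\} \cup \{S \cup \{v\} : S \in \mathcal M(H)\} \cup \{T \subseteq V_1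 : T \in \mathcal M(H)\}.$$ (b) Conversely, if there exists $w \in V_1$ with $\deg_G(w) = 2$ and $J_G$ is unmixed, then $J_H$ is unmixed and the neighbours of the leaves of $H$ are adjacent. -/

import Mathlib

/-- The binomial edge ideal `J_G = (x_i y_j - x_j y_i : {i, j} ∈ E(G))` of a graph `G` on `V`, in the
polynomial ring `K[x_i, y_i : i ∈ V]`; the variable `x_i` is `X (Sum.inl i)` and the variable `y_i`
is `X (Sum.inr i)`. -/
noncomputable def binomialEdgeIdeal {V : Type*} (K : Type*) [Field K] (G : SimpleGraph V) :
    Ideal (MvPolynomial (V ⊕ V) K) :=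
  Ideal.span {p | ∃ i j : V, G.Adj i j ∧
    p = MvPolynomial.X (Sum.inl i) * MvPolynomial.X (Sum.inr j) -
      MvPolynomial.X (Sum.inl j) * MvPolynomial.X (Sum.inr i)}

/-- An ideal is unmixed if all its minimal primes have the same height. -/
def IsUnmixedIdeal {R : Type*} [CommRing R] (I : Ideal R) : Prop :=
  ∀ p ∈ I.minimalPrimes, ∀ q ∈ I.minimalPrimes, p.height = q.height

/-- `c_G(S)`: the number of connected components of the subgraph induced on the complement of
`S`. -/
noncomputable def numComp {V : Type*} (G : SimpleGraph V) (S : Set V) : ℕ :=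
  Nat.card (G.induce Sᶜ).ConnectedComponent

/-- `𝓜(G)`: the set of cut sets of `G`. (The empty set satisfies the condition vacuously.) -/
def cutSets {V : Type*} (G : SimpleGraph V) : Set (Set V) :=
  {S | ∀ i ∈ S, numComp G (S \ {i}) < numComp G S}

/-- A leaf is a vertex of degree one. -/
def IsLeafVertex {V : Type*} (G : SimpleGraph V) (x : V) : Prop :=
  (G.neighborSet x).ncard = 1

/-- The neighbours of the leaves of `G` are adjacent: the neighbours of any two distinct leaves are
adjacent to each other. -/
def LeafNeighborsAdjacent {V : Type*} (G : SimpleGraph V) : Prop :=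
  ∀ l₁ l₂ x₁ x₂ : V, IsLeafVertex G l₁ → IsLeafVertex G l₂ → l₁ ≠ l₂ →
    G.Adj l₁ x₁ → G.Adj l₂ x₂ → G.Adj x₁ x₂

/-- The graph obtained from `H` by adding two new vertices `v = Sum.inr 0` and `f = Sum.inr 1` and the
edges `{v, x}` for `x ∈ V₁ ∪ {f}`. -/
def semicone {V : Type*} (H : SimpleGraph V) (V₁ : Set V) : SimpleGraph (V ⊕ Fin 2) where
  Adj
    | Sum.inl a, Sum.inl b => H.Adj a b
    | Sum.inl a, Sum.inr i => a ∈ V₁ ∧ i = 0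
    | Sum.inr i, Sum.inl a => a ∈ V₁ ∧ i = 0
    | Sum.inr i, Sum.inr j => i ≠ j
  symm := ⟨by
    rintro (a | i) (b | j) h
    · exact SimpleGraph.Adj.symm h
    · exact h
    · exact h
    · exact Ne.symm h⟩
  loopless := ⟨by
    rintro (a | i) h
    · exact H.loopless.irrefl a h
    · exact h rfl⟩

/-! Unmixedness is first turned into counting. For a vertex set S let P_S be the prime generated by
the variables of S and the 2-minors of all pairs lying in one component of G − S; it is realised
here as the kernel of a monomial parametrization. Its height is |V| + |S| − c(S), and the minimal
primes of J_G are the P_S with S a cut set. For connected G the cut set ∅ gives height |V| − 1, so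
J_G is unmixed iff c(S) = |S| + 1 for every cut set S (`isUnmixedIdeal_binomialEdgeIdeal_iff`).

No cut set of the semicone G contains f. Those containing v are S ∪ {v} with S a cut set of H not
containing V₁, and then c_G(S ∪ {v}) = c_H(S) + 1. Those avoiding v are the S ⊆ V₁ in which every
vertex has a neighbour y with N(y) ⊆ S; removing S leaves the component of v and the set Y(S) of
isolated y ∈ V₂ with N(y) ⊆ S, so c_G(S) = |Y(S)| + 1.

Let H be unmixed and let S be of the second kind. Then S minus its leaves is a cut set of H, and
counting components gives |Y(S)| + c(H − S − Y(S)) = |S minus leaves| + 1. The case S = V₁ shows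
that each side has exactly one leaf. For (a), if S misses the leaf of V₁ it is a cut set of H, and
if it contains the leaf it equals V₁ (`eq_left_of_leaf_mem`). Conversely, for a cut set S ⊆ V₁ of H,
all of H − S except Y(S) lies in the component of the leaf (`connIn_leaf`), so S is of the second
kind and |Y(S)| = |S|.

For (b), w is a leaf of H, so no cut set of H contains V₁ and the sets S ∪ {v} make H unmixed. If x
is the neighbour of the leaf of V₁, then N(x) is a cut set of G containing that leaf, and the count
forces N(x) = V₁. -/

section

/-! ### Prime ideals attached to vertex labellings -/

open MvPolynomial

/-- The monomial parametrization `x_i ↦ a_{l i} t_i`, `y_i ↦ b_{l i} t_i` with the variables of the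
vertices in `S` sent to zero; its kernel is the prime ideal attached to `S` when `l` labels the
connected components of the complement of `S`. -/
noncomputable def paramHom {V : Type*} (K : Type*) [Field K] (S : Set V) (l : V → V) :
    MvPolynomial (V ⊕ V) K →ₐ[K] MvPolynomial (V ⊕ V ⊕ V) K :=
  open Classical in
  aeval (Sum.elim
    (fun i => if i ∈ S then 0 else X (Sum.inl (l i)) * X (Sum.inr (Sum.inr i)))
    (fun i => if i ∈ S then 0 else X (Sum.inr (Sum.inl (l i))) * X (Sum.inr (Sum.inr i))))

/-- The kernel of the parametrization `paramHom K S l`. -/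
noncomputable def labelIdeal {V : Type*} (K : Type*) [Field K] (S : Set V) (l : V → V) :
    Ideal (MvPolynomial (V ⊕ V) K) :=
  RingHom.ker (paramHom K S l)

/-- The 2-minor `x_i y_j - x_j y_i`. -/
noncomputable def minor {V : Type*} (K : Type*) [Field K] (i j : V) : MvPolynomial (V ⊕ V) K :=
  X (Sum.inl i) * X (Sum.inr j) - X (Sum.inl j) * X (Sum.inr i)

section

variable {V : Type*} {K : Type*} [Field K] {S T : Set V} {l m : V → V} {i j k : V}

instance labelIdeal_isPrime : (labelIdeal K S l).IsPrime := RingHom.ker_isPrime _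

lemma paramHom_inl_of_mem (h : i ∈ S) : paramHom K S l (X (Sum.inl i)) = 0 := by
  simp [paramHom, h]

lemma paramHom_inr_of_mem (h : i ∈ S) : paramHom K S l (X (Sum.inr i)) = 0 := by
  simp [paramHom, h]

lemma paramHom_inl_of_notMem (h : i ∉ S) : paramHom K S l (X (Sum.inl i)) =
    X (Sum.inl (l i)) * X (Sum.inr (Sum.inr i)) := by
  simp [paramHom, h]

lemma paramHom_inr_of_notMem (h : i ∉ S) : paramHom K S l (X (Sum.inr i)) =
    X (Sum.inr (Sum.inl (l i))) * X (Sum.inr (Sum.inr i)) := by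
  simp [paramHom, h]

lemma X_inl_mem_labelIdeal : X (Sum.inl i) ∈ labelIdeal K S l ↔ i ∈ S := by
  by_cases h : i ∈ S
  · simp [labelIdeal, RingHom.mem_ker, paramHom_inl_of_mem h, h]
  · simp [labelIdeal, RingHom.mem_ker, paramHom_inl_of_notMem h, h]

lemma X_inr_mem_labelIdeal : X (Sum.inr i) ∈ labelIdeal K S l ↔ i ∈ S := by
  by_cases h : i ∈ S
  · simp [labelIdeal, RingHom.mem_ker, paramHom_inr_of_mem h, h]
  · simp [labelIdeal, RingHom.mem_ker, paramHom_inr_of_notMem h, h]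

lemma minor_mem_labelIdeal (h : i ∈ S ∨ j ∈ S ∨ l i = l j) : minor K i j ∈ labelIdeal K S l := by
  by_cases hi : i ∈ S
  · simp [labelIdeal, minor, RingHom.mem_ker, paramHom_inl_of_mem hi, paramHom_inr_of_mem hi]
  by_cases hj : j ∈ S
  · simp [labelIdeal, minor, RingHom.mem_ker, paramHom_inl_of_mem hj, paramHom_inr_of_mem hj]
  have h' : l i = l j := by tauto
  simp only [labelIdeal, minor, RingHom.mem_ker, map_sub, map_mul, paramHom_inl_of_notMem hi,
    paramHom_inr_of_notMem hi, paramHom_inl_of_notMem hj, paramHom_inr_of_notMem hj, h']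
  ring

lemma eq_label_of_minor_mem (h : minor K i j ∈ labelIdeal K S l) (hi : i ∉ S) (hj : j ∉ S) :
    l i = l j := by
  classical
  by_contra hne
  simp only [labelIdeal, minor, RingHom.mem_ker, map_sub, map_mul, paramHom_inl_of_notMem hi,
    paramHom_inr_of_notMem hi, paramHom_inl_of_notMem hj, paramHom_inr_of_notMem hj] at h
  have := congrArg (eval (fun s : V ⊕ V ⊕ V => Sum.elim (fun a => if a = l i then (1 : K) else 0)
    (Sum.elim (fun a => if a = l j then (1 : K) else 0) (fun _ => 1)) s)) h
  simp [hne] at this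

/-- A homomorphism that is parametrized by scalars `α`, `β` on the labels and `τ` on the vertices
kills the label ideal. -/
lemma labelIdeal_le_ker {A : Type*} [CommRing A] [Algebra K A]
    (σ : MvPolynomial (V ⊕ V) K →ₐ[K] A) (α β τ : V → A)
    (hS : ∀ i ∈ S, σ (X (Sum.inl i)) = 0 ∧ σ (X (Sum.inr i)) = 0)
    (hl : ∀ i, i ∉ S → σ (X (Sum.inl i)) = α (l i) * τ i ∧ σ (X (Sum.inr i)) = β (l i) * τ i) :
    labelIdeal K S l ≤ RingHom.ker σ := by
  have key : σ = (aeval (Sum.elim α (Sum.elim β τ))).comp (paramHom K S l) := by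
    apply MvPolynomial.algHom_ext
    rintro (i | i)
    · by_cases h : i ∈ S
      · simp [paramHom_inl_of_mem h, hS i h]
      · simp [paramHom_inl_of_notMem h, hl i h]
    · by_cases h : i ∈ S
      · simp [paramHom_inr_of_mem h, hS i h]
      · simp [paramHom_inr_of_notMem h, hl i h]
  intro p hp
  rw [labelIdeal, RingHom.mem_ker] at hp
  rw [RingHom.mem_ker, key, AlgHom.comp_apply, hp, map_zero]

/-- In the fraction field of the quotient by Q the vanishing minor makes (x_i, y_i) proportional to
the nonzero vector (x_{l i}, y_{l i}). The quotient map thus factors through the parametrization. -/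
lemma labelIdeal_le_of_isPrime {Q : Ideal (MvPolynomial (V ⊕ V) K)} (hQ : Q.IsPrime)
    (hS : ∀ i ∈ S, X (Sum.inl i) ∈ Q ∧ X (Sum.inr i) ∈ Q)
    (hl : ∀ i, i ∉ S → X (Sum.inl (l i)) ∉ Q ∨ X (Sum.inr (l i)) ∉ Q)
    (hm : ∀ i, i ∉ S → minor K i (l i) ∈ Q) : labelIdeal K S l ≤ Q := by
  classical
  let L := FractionRing (MvPolynomial (V ⊕ V) K ⧸ Q)
  let σ : MvPolynomial (V ⊕ V) K →ₐ[K] L :=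
    (IsScalarTower.toAlgHom K (MvPolynomial (V ⊕ V) K ⧸ Q) L).comp (Ideal.Quotient.mkₐ K Q)
  have hσ : ∀ p, σ p = 0 ↔ p ∈ Q := by
    intro p
    have : σ p = algebraMap (MvPolynomial (V ⊕ V) K ⧸ Q) L (Ideal.Quotient.mk Q p) := rfl
    rw [this, FaithfulSMul.algebraMap_eq_zero_iff, Ideal.Quotient.eq_zero_iff_mem]
  have hker : RingHom.ker σ = Q := by
    ext p
    rw [RingHom.mem_ker, hσ]
  rw [← hker]
  -- The factor of proportionality is read off from whichever coordinate of the representative is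
  -- nonzero.
  refine labelIdeal_le_ker σ (fun a => σ (X (Sum.inl a))) (fun a => σ (X (Sum.inr a)))
    (fun i => if X (Sum.inl (l i)) ∈ Q then σ (X (Sum.inr i)) / σ (X (Sum.inr (l i)))
      else σ (X (Sum.inl i)) / σ (X (Sum.inl (l i)))) ?_ ?_
  · intro i hi
    rw [hσ, hσ]
    exact hS i hi
  · intro i hi
    have h1 := (hσ _).2 (hm i hi)
    simp only [minor, map_sub, map_mul] at h1
    by_cases hx : X (Sum.inl (l i)) ∈ Q
    · have hy : σ (X (Sum.inr (l i))) ≠ 0 := by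
        rw [Ne, hσ]
        exact (hl i hi).resolve_left (not_not.2 hx)
      have hx0 := (hσ _).2 hx
      simp only [hx, if_true]
      rw [hx0] at h1 ⊢
      have h2 : σ (X (Sum.inl i)) = 0 := by
        simpa [hy] using h1
      exact ⟨by simp [h2], by rw [← mul_div_assoc, mul_div_cancel_left₀ _ hy]⟩
    · have hx0 : σ (X (Sum.inl (l i))) ≠ 0 := by rwa [Ne, hσ]
      simp only [hx, if_false]
      refine ⟨by rw [← mul_div_assoc, mul_div_cancel_left₀ _ hx0], ?_⟩
      rw [← mul_div_assoc, eq_div_iff hx0]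
      linear_combination -h1

/-- The parametrization for T is a specialization of the one for S: a label a is sent to the m-label
of any vertex outside T carrying a, which does not depend on the choice. Labels not seen outside T
may go to 0, since there the vertex parameter vanishes too. -/
lemma labelIdeal_mono (hST : S ⊆ T)
    (h : ∀ i j, i ∉ T → j ∉ T → l i = l j → m i = m j) :
    labelIdeal K S l ≤ labelIdeal K T m := by
  classical
  refine labelIdeal_le_ker (paramHom K T m)
    (fun a => if h : ∃ j, j ∉ T ∧ l j = a then X (Sum.inl (m h.choose)) else 0)
    (fun a => if h : ∃ j, j ∉ T ∧ l j = a then X (Sum.inr (Sum.inl (m h.choose))) else 0)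
    (fun i => if i ∈ T then 0 else X (Sum.inr (Sum.inr i))) ?_ ?_
  · intro i hi
    exact ⟨paramHom_inl_of_mem (hST hi), paramHom_inr_of_mem (hST hi)⟩
  · intro i _
    by_cases hi : i ∈ T
    · simp [hi, paramHom_inl_of_mem, paramHom_inr_of_mem]
    · have hex : ∃ j, j ∉ T ∧ l j = l i := ⟨i, hi, rfl⟩
      have := h _ _ hex.choose_spec.1 hi hex.choose_spec.2
      simp only [hex, hi, dif_pos, if_false, this]
      exact ⟨paramHom_inl_of_notMem hi, paramHom_inr_of_notMem hi⟩

lemma subset_of_labelIdeal_le (h : labelIdeal K S l ≤ labelIdeal K T m) : S ⊆ T :=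
  fun _ hi => X_inl_mem_labelIdeal.1 (h (X_inl_mem_labelIdeal.2 hi))

lemma label_eq_of_labelIdeal_le (h : labelIdeal K S l ≤ labelIdeal K T m) (hi : i ∉ T)
    (hj : j ∉ T) (hij : l i = l j) : m i = m j :=
  eq_label_of_minor_mem (h (minor_mem_labelIdeal (Or.inr (Or.inr hij)))) hi hj

lemma minor_trans_mem {Q : Ideal (MvPolynomial (V ⊕ V) K)} (hQ : Q.IsPrime)
    (hij : minor K i j ∈ Q) (hjk : minor K j k ∈ Q)
    (hj : X (Sum.inl j) ∉ Q ∨ X (Sum.inr j) ∉ Q) : minor K i k ∈ Q := by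
  rcases hj with hj | hj
  · refine (hQ.mem_or_mem (x := X (Sum.inl j)) ?_).resolve_left hj
    have : X (Sum.inl j) * minor K i k =
        X (Sum.inl i) * minor K j k + X (Sum.inl k) * minor K i j := by
      simp only [minor]; ring
    rw [this]
    exact Q.add_mem (Q.mul_mem_left _ hjk) (Q.mul_mem_left _ hij)
  · refine (hQ.mem_or_mem (x := X (Sum.inr j)) ?_).resolve_left hj
    have : X (Sum.inr j) * minor K i k =
        X (Sum.inr i) * minor K j k + X (Sum.inr k) * minor K i j := by
      simp only [minor]; ring
    rw [this]
    exact Q.add_mem (Q.mul_mem_left _ hjk) (Q.mul_mem_left _ hij)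

/-! ### Heights -/

/-- The prime ideal generated by the variables in `Z`, as the kernel of the evaluation at zero. -/
noncomputable def varIdeal {ι : Type*} (K : Type*) [Field K] (Z : Set ι) :
    Ideal (MvPolynomial ι K) :=
  open Classical in
  RingHom.ker (aeval (fun s => if s ∈ Z then 0 else X s) : MvPolynomial ι K →ₐ[K] MvPolynomial ι K)

instance varIdeal_isPrime {ι : Type*} {Z : Set ι} : (varIdeal K Z).IsPrime := RingHom.ker_isPrime _

lemma X_mem_varIdeal {ι : Type*} {Z : Set ι} {s : ι} : X s ∈ varIdeal K Z ↔ s ∈ Z := by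
  by_cases h : s ∈ Z <;> simp [varIdeal, RingHom.mem_ker, h]

lemma varIdeal_le_ker {ι A : Type*} [CommRing A] [Algebra K A] {Z : Set ι}
    (σ : MvPolynomial ι K →ₐ[K] A) (h : ∀ s ∈ Z, σ (X s) = 0) : varIdeal K Z ≤ RingHom.ker σ := by
  classical
  have key : σ = (aeval (fun s => σ (X s))).comp
      (aeval (fun s => if s ∈ Z then 0 else X s) : MvPolynomial ι K →ₐ[K] MvPolynomial ι K) := by
    apply MvPolynomial.algHom_ext
    intro s
    by_cases hs : s ∈ Z <;> simp [hs, h]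
  intro p hp
  rw [varIdeal, RingHom.mem_ker] at hp
  have hp' : (aeval (fun s => if s ∈ Z then 0 else X s) :
      MvPolynomial ι K →ₐ[K] MvPolynomial ι K) p = 0 := by
    convert hp
  rw [RingHom.mem_ker, key, AlgHom.comp_apply, hp', map_zero]

lemma card_le_height_varIdeal {ι : Type*} (Z : Finset ι) :
    (Z.card : ℕ∞) ≤ (varIdeal K (Z : Set ι)).height := by
  classical
  induction Z using Finset.induction_on with
  | empty => simp
  | insert a Z ha ih =>
    have hle : varIdeal K (Z : Set ι) ≤ varIdeal K (insert a Z : Finset ι) := by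
      refine varIdeal_le_ker _ fun s hs => ?_
      have : s ∈ ((insert a Z : Finset ι) : Set ι) := by simp [Finset.mem_coe.1 hs]
      simpa [varIdeal, RingHom.mem_ker] using X_mem_varIdeal (K := K).2 this
    have hlt : varIdeal K (Z : Set ι) < varIdeal K (insert a Z : Finset ι) := by
      refine lt_of_le_of_ne hle fun h => ?_
      have h1 : X a ∈ varIdeal K ((insert a Z : Finset ι) : Set ι) := X_mem_varIdeal.2 (by simp)
      rw [← h, X_mem_varIdeal] at h1
      exact ha (by simpa using h1)
    rw [Finset.card_insert_of_notMem ha]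
    rw [Nat.cast_succ]
    exact (add_le_add_left ih 1).trans (Ideal.height_add_one_le_of_lt_of_isPrime hlt)

lemma two_mul_ncard_le_height_labelIdeal [Finite V] :
    ((2 * S.ncard : ℕ) : ℕ∞) ≤ (labelIdeal K S l).height := by
  classical
  have hfin : (Sum.inl '' S ∪ Sum.inr '' S : Set (V ⊕ V)).Finite := Set.toFinite _
  have hle : varIdeal K (hfin.toFinset : Set (V ⊕ V)) ≤ labelIdeal K S l := by
    refine varIdeal_le_ker _ fun s hs => ?_
    rw [Set.Finite.coe_toFinset] at hs
    rcases hs with ⟨i, hi, rfl⟩ | ⟨i, hi, rfl⟩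
    · exact paramHom_inl_of_mem hi
    · exact paramHom_inr_of_mem hi
  refine le_trans ?_ ((card_le_height_varIdeal hfin.toFinset).trans (Ideal.height_mono hle))
  rw [← Set.ncard_eq_toFinset_card _ hfin, Set.ncard_union_eq, Set.ncard_image_of_injective _
    Sum.inl_injective, Set.ncard_image_of_injective _ Sum.inr_injective, two_mul]
  rw [Set.disjoint_left]
  rintro _ ⟨i, _, rfl⟩ ⟨j, _, h⟩
  cases h

/-- A chain of primes is built by giving one vertex a fresh label at a time: each split strictly
shrinks the ideal, and the 2|S| variables bound the height at the bottom. -/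
lemma le_height_labelIdeal [Finite V] (d : ℕ) :
    ∀ l : V → V, (l '' Sᶜ).ncard + d ≤ Sᶜ.ncard →
      ((2 * S.ncard + d : ℕ) : ℕ∞) ≤ (labelIdeal K S l).height := by
  classical
  induction d with
  | zero => exact fun l _ => two_mul_ncard_le_height_labelIdeal
  | succ d ih =>
    intro l hd
    have hninj : ¬ Set.InjOn l Sᶜ := by
      intro h
      rw [h.ncard_image] at hd
      omega
    simp only [Set.InjOn, not_forall] at hninj
    obtain ⟨i, hi, j, hj, hij, hne⟩ := hninj
    -- A fresh label exists because fewer than |Sᶜ| ≤ |V| labels are in use.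
    obtain ⟨a, ha⟩ : ∃ a, a ∉ l '' Sᶜ := by
      by_contra! h
      have h1 : l '' Sᶜ = Set.univ := Set.eq_univ_of_forall h
      have h2 := Set.ncard_le_ncard (Set.subset_univ Sᶜ)
      rw [h1] at hd
      omega
    have himg : Function.update l i a '' Sᶜ ⊆ insert a (l '' Sᶜ) := by
      rintro _ ⟨u, hu, rfl⟩
      by_cases h : u = i
      · subst h; simp
      · rw [Function.update_of_ne h]
        exact Or.inr ⟨u, hu, rfl⟩
    have hcard : (Function.update l i a '' Sᶜ).ncard + d ≤ Sᶜ.ncard := by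
      have h1 := Set.ncard_le_ncard himg
      have h2 := Set.ncard_insert_le a (l '' Sᶜ)
      omega
    have hle : labelIdeal K S (Function.update l i a) ≤ labelIdeal K S l := by
      refine labelIdeal_mono subset_rfl fun u w hu hw huw => ?_
      by_cases h1 : u = i <;> by_cases h2 : w = i
      · rw [h1, h2]
      · subst h1
        rw [Function.update_self, Function.update_of_ne h2] at huw
        exact absurd ⟨w, hw, huw.symm⟩ ha
      · subst h2
        rw [Function.update_self, Function.update_of_ne h1] at huw
        exact absurd ⟨u, hu, huw⟩ ha
      · rwa [Function.update_of_ne h1, Function.update_of_ne h2] at huw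
    have hlt : labelIdeal K S (Function.update l i a) < labelIdeal K S l := by
      refine lt_of_le_of_ne hle fun h => ?_
      have h1 := label_eq_of_labelIdeal_le h.ge hi hj hij
      rw [Function.update_self, Function.update_of_ne (Ne.symm hne)] at h1
      exact ha ⟨j, hj, h1.symm⟩
    have h2 := (add_le_add_left (ih _ hcard) 1).trans
      (Ideal.height_add_one_le_of_lt_of_isPrime hlt)
    refine le_trans (le_of_eq ?_) h2
    push_cast
    ring

/-- By Krull's height theorem: the prime is minimal over the variables of S together with one minor
for each vertex that is not a representative. -/
lemma height_labelIdeal_le [Finite V] (hl : ∀ i, i ∉ S → l i ∉ S)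
    (hll : ∀ i, i ∉ S → l (l i) = l i) :
    (labelIdeal K S l).height ≤ ((2 * S.ncard + (Sᶜ.ncard - (l '' Sᶜ).ncard) : ℕ) : ℕ∞) := by
  classical
  let gens : Set (MvPolynomial (V ⊕ V) K) :=
    ((fun i => X (Sum.inl i)) '' S ∪ (fun i => X (Sum.inr i)) '' S) ∪
      (fun i => minor K i (l i)) '' (Sᶜ \ l '' Sᶜ)
  have hfin : gens.Finite := Set.toFinite _
  have hmin : labelIdeal K S l ∈ (Ideal.span gens).minimalPrimes := by
    refine ⟨⟨inferInstance, Ideal.span_le.2 ?_⟩, ?_⟩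
    · rintro _ ((⟨i, hi, rfl⟩ | ⟨i, hi, rfl⟩) | ⟨i, hi, rfl⟩)
      · exact X_inl_mem_labelIdeal.2 hi
      · exact X_inr_mem_labelIdeal.2 hi
      · exact minor_mem_labelIdeal (Or.inr (Or.inr (hll i hi.1).symm))
    · rintro Q ⟨hQ, hgQ⟩ hQP
      rw [Ideal.span_le] at hgQ
      refine labelIdeal_le_of_isPrime hQ (fun i hi => ⟨hgQ (Or.inl (Or.inl ⟨i, hi, rfl⟩)),
        hgQ (Or.inl (Or.inr ⟨i, hi, rfl⟩))⟩) (fun i hi => Or.inl fun h => ?_) fun i hi => ?_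
      · exact hl i hi (X_inl_mem_labelIdeal.1 (hQP h))
      · by_cases h : i ∈ l '' Sᶜ
        · obtain ⟨j, hj, rfl⟩ := h
          rw [hll j hj]
          simp [minor]
        · exact hgQ (Or.inr ⟨i, ⟨hi, h⟩, rfl⟩)
  refine (Ideal.height_le_card_of_mem_minimalPrimes_span hfin hmin).trans ?_
  norm_cast
  refine (Set.ncard_union_le _ _).trans (add_le_add ?_ ?_)
  · refine (Set.ncard_union_le _ _).trans ?_
    rw [two_mul]
    exact add_le_add (Set.ncard_image_le (Set.toFinite _)) (Set.ncard_image_le (Set.toFinite _))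
  · refine (Set.ncard_image_le (Set.toFinite _)).trans (le_of_eq ?_)
    rw [Set.ncard_sdiff]
    rintro _ ⟨i, hi, rfl⟩
    exact hl i hi

lemma height_labelIdeal [Finite V] (hl : ∀ i, i ∉ S → l i ∉ S)
    (hll : ∀ i, i ∉ S → l (l i) = l i) :
    (labelIdeal K S l).height = ((2 * S.ncard + (Sᶜ.ncard - (l '' Sᶜ).ncard) : ℕ) : ℕ∞) := by
  refine le_antisymm (height_labelIdeal_le hl hll) (le_height_labelIdeal _ _ ?_)
  have := Set.ncard_image_le (f := l) (Set.toFinite Sᶜ)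
  omega

end

end

/-! ### Connectivity and component counts inside a vertex set -/

/-- `u` and `w` are joined by a walk of `G` inside `A`. -/
def ConnIn {V : Type*} (G : SimpleGraph V) (A : Set V) : V → V → Prop :=
  Relation.ReflTransGen fun a b => a ∈ A ∧ b ∈ A ∧ G.Adj a b

/-- The number of connected components of the subgraph induced on `A`. -/
noncomputable def compCount {V : Type*} (G : SimpleGraph V) (A : Set V) : ℕ :=
  Nat.card (G.induce A).ConnectedComponent

/-- `i` has neighbours in two distinct connected components of the subgraph induced on `A`. -/
def JoinsIn {V : Type*} (G : SimpleGraph V) (A : Set V) (i : V) : Prop :=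
  ∃ u ∈ A, ∃ w ∈ A, G.Adj i u ∧ G.Adj i w ∧ ¬ ConnIn G A u w

namespace ConnIn

variable {V : Type*} {G : SimpleGraph V} {A B : Set V} {u w z : V}

/-- Membership in `A` is not required: a vertex outside `A` is a class by itself, so this is an
equivalence on all of `V` and representatives form a labelling `V → V`. -/
lemma refl (u : V) : ConnIn G A u u := Relation.ReflTransGen.refl

lemma symm (h : ConnIn G A u w) : ConnIn G A w u := by
  induction h with
  | refl => exact refl _
  | tail _ h ih => exact Relation.ReflTransGen.head ⟨h.2.1, h.1, h.2.2.symm⟩ ih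

lemma trans (h : ConnIn G A u w) (h' : ConnIn G A w z) : ConnIn G A u z :=
  Relation.ReflTransGen.trans h h'

lemma of_adj (hu : u ∈ A) (hw : w ∈ A) (h : G.Adj u w) : ConnIn G A u w :=
  Relation.ReflTransGen.single ⟨hu, hw, h⟩

lemma mono (hAB : A ⊆ B) (h : ConnIn G A u w) : ConnIn G B u w := by
  induction h with
  | refl => exact refl _
  | tail _ h ih => exact ih.tail ⟨hAB h.1, hAB h.2.1, h.2.2⟩

/-- A property that is preserved along the edges inside `A` is preserved along walks. -/
lemma induct (p : V → Prop) (hp : ∀ a ∈ A, ∀ b ∈ A, G.Adj a b → p a → p b)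
    (h : ConnIn G A u w) (hu : p u) : p w := by
  induction h with
  | refl => exact hu
  | tail _ h ih => exact hp _ h.1 _ h.2.1 h.2.2 ih

lemma mem (h : ConnIn G A u w) (hu : u ∈ A) : w ∈ A :=
  h.induct (· ∈ A) (fun _ _ _ hb _ _ => hb) hu

lemma iff_reachable (hu : u ∈ A) (hw : w ∈ A) :
    ConnIn G A u w ↔ (G.induce A).Reachable ⟨u, hu⟩ ⟨w, hw⟩ := by
  constructor
  · intro h
    have := h.induct (fun z => ∃ hz : z ∈ A, (G.induce A).Reachable ⟨u, hu⟩ ⟨z, hz⟩) ?_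
      ⟨hu, SimpleGraph.Reachable.refl _⟩
    · exact this.2
    · rintro a ha b hb hab ⟨_, hr⟩
      refine ⟨hb, hr.trans (SimpleGraph.Adj.reachable ?_)⟩
      exact hab
  · intro h
    rw [SimpleGraph.reachable_iff_reflTransGen] at h
    have : ∀ z : A, Relation.ReflTransGen (G.induce A).Adj ⟨u, hu⟩ z → ConnIn G A u z := by
      intro z hz
      induction hz with
      | refl => exact refl _
      | @tail b c _ hbc ih => exact ih.trans (of_adj b.2 c.2 hbc)
    exact this _ h

/-- The setoid of being connected inside `A`. -/
def setoid (G : SimpleGraph V) (A : Set V) : Setoid V :=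
  ⟨ConnIn G A, refl, symm, trans⟩

end ConnIn

lemma SimpleGraph.Connected.connIn_univ {V : Type*} {G : SimpleGraph V} (h : G.Connected)
    (u w : V) : ConnIn G Set.univ u w := by
  have := (SimpleGraph.reachable_iff_reflTransGen u w).1 (h.preconnected u w)
  induction this with
  | refl => exact ConnIn.refl _
  | tail _ h ih => exact ih.tail ⟨trivial, trivial, h⟩

/-- A representative of the component of a vertex in the subgraph induced on `A`. -/
noncomputable def compRep {V : Type*} (G : SimpleGraph V) (A : Set V) (u : V) : V :=
  (Quotient.mk (ConnIn.setoid G A) u).out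

section

variable {V : Type*} {G : SimpleGraph V} {A B S : Set V} {u w i : V}

lemma connIn_compRep (u : V) : ConnIn G A (compRep G A u) u :=
  Quotient.exact (s := ConnIn.setoid G A) (Quotient.out_eq _)

lemma compRep_eq_iff : compRep G A u = compRep G A w ↔ ConnIn G A u w := by
  constructor
  · intro h
    have h2 := connIn_compRep (G := G) (A := A) u
    rw [h] at h2
    exact h2.symm.trans (connIn_compRep w)
  · intro h
    have : Quotient.mk (ConnIn.setoid G A) u = Quotient.mk (ConnIn.setoid G A) w :=
      Quotient.sound h
    rw [compRep, this, compRep]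

lemma compRep_mem (hu : u ∈ A) : compRep G A u ∈ A := (connIn_compRep u).symm.mem hu

lemma compRep_compRep (u : V) : compRep G A (compRep G A u) = compRep G A u :=
  compRep_eq_iff.2 (connIn_compRep u)

/-- Components are counted by any labelling that is constant exactly on the components. -/
lemma compCount_eq_ncard_image {W : Type*} (f : V → W)
    (hf : ∀ u ∈ A, ∀ w ∈ A, f u = f w ↔ ConnIn G A u w) : compCount G A = (f '' A).ncard := by
  rw [compCount, ← Nat.card_coe_set_eq]
  refine Nat.card_congr (Equiv.ofBijective (SimpleGraph.ConnectedComponent.lift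
    (fun v => ⟨f v, v, v.2, rfl⟩) ?_) ⟨?_, ?_⟩)
  · rintro ⟨a, ha⟩ ⟨b, hb⟩ p _
    exact Subtype.ext ((hf a ha b hb).2 ((ConnIn.iff_reachable ha hb).2 p.reachable))
  · intro c d
    induction c using SimpleGraph.ConnectedComponent.ind with | h a =>
    induction d using SimpleGraph.ConnectedComponent.ind with | h b =>
    intro h
    have h' : f a = f b := congrArg Subtype.val h
    exact SimpleGraph.ConnectedComponent.sound
      ((ConnIn.iff_reachable a.2 b.2).1 ((hf a a.2 b b.2).1 h'))
  · rintro ⟨_, a, ha, rfl⟩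
    exact ⟨(G.induce A).connectedComponentMk ⟨a, ha⟩, rfl⟩

lemma compCount_eq_ncard_compRep : compCount G A = (compRep G A '' A).ncard :=
  compCount_eq_ncard_image _ fun _ _ _ _ => compRep_eq_iff

lemma compCount_empty : compCount G (∅ : Set V) = 0 := by
  rw [compCount_eq_ncard_compRep]; simp

lemma compCount_pos [Finite V] (h : A.Nonempty) : 0 < compCount G A := by
  rw [compCount_eq_ncard_compRep, Set.ncard_pos]
  exact h.image _

lemma compCount_eq_one (hu : u ∈ A) (h : ∀ w ∈ A, ConnIn G A u w) : compCount G A = 1 := by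
  rw [compCount_eq_ncard_image (fun _ => ()), Set.Nonempty.image_const ⟨u, hu⟩,
    Set.ncard_singleton]
  exact fun a ha b hb => ⟨fun _ => (h a ha).symm.trans (h b hb), fun _ => rfl⟩

lemma compCount_of_indep (h : ∀ a ∈ A, ∀ b ∈ A, ¬ G.Adj a b) : compCount G A = A.ncard := by
  rw [compCount_eq_ncard_image id, Set.image_id]
  intro u _ w _
  refine ⟨?_, fun hc => ?_⟩
  · rintro rfl
    exact ConnIn.refl _
  exact hc.induct (fun z => u = z) (fun a ha b hb hab _ => absurd hab (h a ha b hb)) rfl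

lemma ConnIn.of_union (hAB : ∀ a ∈ A, ∀ b ∈ B, ¬ G.Adj a b) (hu : u ∈ A)
    (h : ConnIn G (A ∪ B) u w) : w ∈ A ∧ ConnIn G A u w := by
  refine h.induct (fun z => z ∈ A ∧ ConnIn G A u z) ?_ ⟨hu, ConnIn.refl _⟩
  rintro a _ b hb hab ⟨ha, hua⟩
  have hbA : b ∈ A := hb.resolve_right fun hb => hAB a ha b hb hab
  exact ⟨hbA, hua.trans (ConnIn.of_adj ha hbA hab)⟩

/-- Component counts add up over parts with no edges between them. -/
lemma compCount_union [Finite V] (hd : Disjoint A B) (hAB : ∀ a ∈ A, ∀ b ∈ B, ¬ G.Adj a b) :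
    compCount G (A ∪ B) = compCount G A + compCount G B := by
  have hBA : ∀ b ∈ B, ∀ a ∈ A, ¬ G.Adj b a := fun b hb a ha h => hAB a ha b hb h.symm
  rw [compCount_eq_ncard_compRep, Set.image_union, Set.ncard_union_eq,
    ← compCount_eq_ncard_image, ← compCount_eq_ncard_image]
  · intro u hu w _
    rw [compRep_eq_iff]
    refine ⟨fun h => ?_, fun h => h.mono Set.subset_union_right⟩
    rw [Set.union_comm] at h
    exact (h.of_union hBA hu).2
  · intro u hu w _
    rw [compRep_eq_iff]
    exact ⟨fun h => (h.of_union hAB hu).2, fun h => h.mono Set.subset_union_left⟩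
  · rw [Set.disjoint_left]
    rintro _ ⟨a, ha, rfl⟩ ⟨b, hb, h⟩
    exact Set.disjoint_left.1 hd ((compRep_eq_iff.1 h.symm).of_union hAB ha).1 hb

lemma ConnIn.of_insert (hJ : ¬ JoinsIn G A i) (hu : u ∈ A) (hw : w ∈ A) (hi : i ∉ A)
    (h : ConnIn G (insert i A) u w) : ConnIn G A u w := by
  have := h.induct (fun z => (z ≠ i → ConnIn G A u z) ∧
    (z = i → ∃ n ∈ A, G.Adj i n ∧ ConnIn G A u n)) ?_
    ⟨fun _ => ConnIn.refl _, fun h => absurd hu (h ▸ hi)⟩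
  · exact this.1 fun h => hi (h ▸ hw)
  · rintro a ha b hb hab ⟨h1, h2⟩
    by_cases hai : a = i
    · obtain ⟨n, hn, hin, hun⟩ := h2 hai
      refine ⟨fun hbi => ?_, fun hbi => ?_⟩
      · have hbA := hb.resolve_left hbi
        by_contra hcon
        exact hJ ⟨n, hn, b, hbA, hin, hai ▸ hab, fun hnb => hcon (hun.trans hnb)⟩
      · exact absurd hab (by rw [hai, hbi]; exact G.irrefl)
    · have haA := ha.resolve_left hai
      refine ⟨fun hbi => (h1 hai).trans (ConnIn.of_adj haA (hb.resolve_left hbi) hab),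
        fun hbi => ⟨a, haA, ?_, h1 hai⟩⟩
      rw [← hbi]
      exact hab.symm

lemma compCount_eq_ncard_image_insert (hJ : ¬ JoinsIn G A i) (hi : i ∉ A) :
    compCount G A = (compRep G (insert i A) '' A).ncard := by
  refine compCount_eq_ncard_image _ fun u hu w hw => ?_
  rw [compRep_eq_iff]
  exact ⟨fun h => h.of_insert hJ hu hw hi, fun h => h.mono (Set.subset_insert _ _)⟩

lemma image_compRep_insert (hn : u ∈ A) (hin : G.Adj i u) :
    compRep G (insert i A) '' insert i A = compRep G (insert i A) '' A := by
  rw [Set.image_insert_eq, Set.insert_eq_of_mem]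
  exact ⟨u, hn, compRep_eq_iff.2 (ConnIn.of_adj (Or.inr hn) (Or.inl rfl) hin.symm)⟩

/-- Adding a vertex attached to exactly one component does not change the count. -/
lemma compCount_insert (hJ : ¬ JoinsIn G A i) (hi : i ∉ A) (hn : u ∈ A) (hin : G.Adj i u) :
    compCount G (insert i A) = compCount G A := by
  rw [compCount_eq_ncard_image_insert hJ hi, compCount_eq_ncard_compRep,
    image_compRep_insert hn hin]

/-- If `i` has a neighbour in `A`, the components of `insert i A` arise by merging components of
`A`, and the count drops exactly when two of them are merged. An isolated `i` only adds a component.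
-/
lemma compCount_insert_lt_iff [Finite V] (hi : i ∉ A) :
    compCount G (insert i A) < compCount G A ↔ JoinsIn G A i := by
  constructor
  · intro h
    by_contra hJ
    rw [compCount_eq_ncard_image_insert hJ hi, compCount_eq_ncard_compRep] at h
    have := Set.ncard_le_ncard (Set.image_mono (f := compRep G (insert i A))
      (Set.subset_insert i A))
    omega
  · rintro ⟨u, hu, w, hw, hiu, hiw, hn⟩
    rw [compCount_eq_ncard_compRep, compCount_eq_ncard_compRep (A := A),
      image_compRep_insert hu hiu]
    have himg : compRep G (insert i A) '' A = compRep G (insert i A) '' (compRep G A '' A) := by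
      rw [← Set.image_comp]
      refine Set.image_congr fun a _ => ?_
      exact (compRep_eq_iff.2 ((connIn_compRep a).mono (Set.subset_insert _ _))).symm
    rw [himg]
    refine lt_of_le_of_ne (Set.ncard_image_le (Set.toFinite _)) fun h => ?_
    rw [Set.ncard_image_iff] at h
    have h1 : ConnIn G (insert i A) (compRep G A u) (compRep G A w) := by
      have hui : ConnIn G (insert i A) u w :=
        (ConnIn.of_adj (Set.mem_insert_of_mem _ hu) (Set.mem_insert _ _) hiu.symm).trans
          (ConnIn.of_adj (Set.mem_insert _ _) (Set.mem_insert_of_mem _ hw) hiw)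
      exact ((connIn_compRep u).mono (Set.subset_insert _ _)).trans
        (hui.trans ((connIn_compRep w).symm.mono (Set.subset_insert _ _)))
    exact hn (compRep_eq_iff.1 (h ⟨u, hu, rfl⟩ ⟨w, hw, rfl⟩ (compRep_eq_iff.2 h1)))

lemma numComp_eq_compCount : numComp G S = compCount G Sᶜ := rfl

lemma mem_cutSets_iff [Finite V] : S ∈ cutSets G ↔ ∀ i ∈ S, JoinsIn G Sᶜ i := by
  refine forall₂_congr fun i hi => ?_
  rw [numComp_eq_compCount, numComp_eq_compCount, ← compCount_insert_lt_iff (by simpa using hi)]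
  have : (S \ {i})ᶜ = insert i Sᶜ := by
    ext z
    simp only [Set.mem_compl_iff, Set.mem_sdiff, Set.mem_singleton_iff, Set.mem_insert_iff]
    tauto
  rw [this]

lemma empty_mem_cutSets : ∅ ∈ cutSets G := fun _ h => absurd h (Set.notMem_empty _)

/-- Leaves hanging off the independent set `A` do not change the number of components. -/
lemma compCount_union_of_pendant [Finite V] (hA : ∀ a ∈ A, ∀ b ∈ A, ¬ G.Adj a b)
    (hd : Disjoint A B) (hB : ∀ b ∈ B, ∃ a ∈ A, G.Adj b a ∧ ∀ z, G.Adj b z → z = a) :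
    compCount G (A ∪ B) = A.ncard := by
  induction B, B.toFinite using Set.Finite.induction_on with
  | empty => rw [Set.union_empty, compCount_of_indep hA]
  | @insert b B hb _ ih =>
    obtain ⟨a, ha, hba, hz⟩ := hB b (Set.mem_insert _ _)
    rw [Set.union_insert, compCount_insert _ _ (Set.mem_union_left _ ha) hba,
      ih (hd.mono_right (Set.subset_insert _ _)) fun c hc => hB c (Or.inr hc)]
    · rintro ⟨u, _, w, _, hu, hw, hn⟩
      exact hn (by rw [hz u hu, hz w hw]; exact ConnIn.refl _)
    · rintro (h | h)
      · exact Set.disjoint_left.1 hd h (Set.mem_insert _ _)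
      · exact hb h

/-- If all neighbours of `u` in `A` have no other neighbour in `A`, then `u` is not connected inside
`A` to vertices at distance at least two. -/
lemma not_connIn_of_pendant (hne : u ≠ w) (hadj : ¬ G.Adj u w)
    (h : ∀ z ∈ A, G.Adj u z → ∀ a ∈ A, G.Adj z a → a = u) : ¬ ConnIn G A u w := by
  intro hc
  have := hc.induct (fun z => z = u ∨ G.Adj u z) (by
    rintro a ha b hb hab (rfl | h1)
    · exact Or.inr hab
    · exact Or.inl (h a ha h1 b hb hab)) (Or.inl rfl)
  exact this.elim (fun h1 => hne h1.symm) hadj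

end

/-! ### Minimal primes of binomial edge ideals -/

section

variable {V : Type*} {K : Type*} [Field K] {G : SimpleGraph V} {S T : Set V}

/-- The prime ideal attached to a set `S` of vertices. -/
noncomputable def componentIdeal (K : Type*) [Field K] (G : SimpleGraph V) (S : Set V) :
    Ideal (MvPolynomial (V ⊕ V) K) :=
  labelIdeal K S (compRep G Sᶜ)

instance : (componentIdeal K G S).IsPrime := labelIdeal_isPrime

lemma minor_mem_binomialEdgeIdeal {i j : V} (h : G.Adj i j) :
    minor K i j ∈ binomialEdgeIdeal K G :=
  Ideal.subset_span ⟨i, j, h, rfl⟩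

lemma binomialEdgeIdeal_le_componentIdeal : binomialEdgeIdeal K G ≤ componentIdeal K G S := by
  refine Ideal.span_le.2 ?_
  rintro _ ⟨i, j, hij, rfl⟩
  refine minor_mem_labelIdeal (i := i) (j := j) ?_
  by_cases hi : i ∈ S
  · exact Or.inl hi
  by_cases hj : j ∈ S
  · exact Or.inr (Or.inl hj)
  · exact Or.inr (Or.inr (compRep_eq_iff.2 (ConnIn.of_adj hi hj hij)))

/-- Take for S the vertices both of whose variables lie in Q. Along a walk outside S the minors of
consecutive vertices compose, since no vertex on it has both variables in Q. -/
lemma exists_componentIdeal_le {Q : Ideal (MvPolynomial (V ⊕ V) K)} (hQ : Q.IsPrime)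
    (h : binomialEdgeIdeal K G ≤ Q) : ∃ S, componentIdeal K G S ≤ Q := by
  let S : Set V := {i | MvPolynomial.X (Sum.inl i) ∈ Q ∧ MvPolynomial.X (Sum.inr i) ∈ Q}
  have hS : ∀ i, i ∉ S → MvPolynomial.X (Sum.inl i) ∉ Q ∨ MvPolynomial.X (Sum.inr i) ∉ Q :=
    fun i hi => by
      by_contra! hc
      exact hi hc
  refine ⟨S, labelIdeal_le_of_isPrime hQ (fun i hi => hi)
    (fun i hi => hS _ (compRep_mem (A := Sᶜ) hi)) fun i hi => ?_⟩
  refine (connIn_compRep (A := Sᶜ) i).symm.induct (fun z => minor K i z ∈ Q) ?_ (by simp [minor])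
  intro a ha b _ hab hia
  exact minor_trans_mem hQ hia (h (minor_mem_binomialEdgeIdeal hab)) (hS a ha)

lemma componentIdeal_le_iff : componentIdeal K G S ≤ componentIdeal K G T ↔
    S ⊆ T ∧ ∀ i ∈ Tᶜ, ∀ j ∈ Tᶜ, ConnIn G Sᶜ i j → ConnIn G Tᶜ i j := by
  constructor
  · intro h
    exact ⟨subset_of_labelIdeal_le h, fun i hi j hj hij =>
      compRep_eq_iff.1 (label_eq_of_labelIdeal_le h hi hj (compRep_eq_iff.2 hij))⟩
  · rintro ⟨h1, h2⟩
    exact labelIdeal_mono h1 fun i j hi hj hij =>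
      compRep_eq_iff.2 (h2 i hi j hj (compRep_eq_iff.1 hij))

/-- The minimal primes of a binomial edge ideal are the ideals attached to the cut sets. -/
lemma mem_minimalPrimes_binomialEdgeIdeal_iff [Finite V] {P : Ideal (MvPolynomial (V ⊕ V) K)} :
    P ∈ (binomialEdgeIdeal K G).minimalPrimes ↔ ∃ S ∈ cutSets G, P = componentIdeal K G S := by
  constructor
  · rintro ⟨⟨hP, hle⟩, hmin⟩
    obtain ⟨S, hS⟩ := exists_componentIdeal_le hP hle
    obtain rfl := le_antisymm (hmin ⟨inferInstance, binomialEdgeIdeal_le_componentIdeal⟩ hS) hS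
    refine ⟨S, mem_cutSets_iff.2 fun i hi => ?_, rfl⟩
    by_contra hJ
    have hc : (S \ {i})ᶜ = insert i Sᶜ := by
      ext z
      simp only [Set.mem_compl_iff, Set.mem_sdiff, Set.mem_singleton_iff, Set.mem_insert_iff]
      tauto
    -- If `i` joins no two components, returning it to the graph merges nothing, so the smaller set
    -- would give a smaller prime.
    have hle' : componentIdeal K G (S \ {i}) ≤ componentIdeal K G S := by
      refine componentIdeal_le_iff.2 ⟨Set.sdiff_subset, fun a ha b hb hab => ?_⟩
      rw [hc] at hab
      exact hab.of_insert hJ ha hb (by simpa using hi)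
    have := hmin ⟨inferInstance, binomialEdgeIdeal_le_componentIdeal⟩ hle'
    exact ((componentIdeal_le_iff.1 this).1 hi).2 rfl
  · rintro ⟨S, hS, rfl⟩
    refine ⟨⟨inferInstance, binomialEdgeIdeal_le_componentIdeal⟩, ?_⟩
    rintro Q ⟨hQ, hle⟩ hQS
    obtain ⟨T, hT⟩ := exists_componentIdeal_le hQ hle
    obtain ⟨hTS, hconn⟩ := componentIdeal_le_iff.1 (hT.trans hQS)
    -- A vertex of S outside T would connect, outside T, two vertices lying in different components
    -- of the complement of S.
    have : S ⊆ T := by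
      intro i hi
      by_contra hiT
      obtain ⟨u, hu, w, hw, hiu, hiw, hn⟩ := mem_cutSets_iff.1 hS i hi
      have hu' : u ∈ Tᶜ := fun h => hu (hTS h)
      have hw' : w ∈ Tᶜ := fun h => hw (hTS h)
      exact hn (hconn u hu w hw ((ConnIn.of_adj hu' hiT hiu.symm).trans
        (ConnIn.of_adj hiT hw' hiw)))
    rwa [Set.Subset.antisymm this hTS]

lemma height_componentIdeal [Finite V] :
    (componentIdeal K G S).height =
      ((2 * S.ncard + (Sᶜ.ncard - numComp G S) : ℕ) : ℕ∞) := by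
  rw [numComp_eq_compCount, compCount_eq_ncard_compRep]
  exact height_labelIdeal (fun i hi => compRep_mem (A := Sᶜ) hi) fun i _ => compRep_compRep i

lemma numComp_le [Finite V] : numComp G S ≤ Sᶜ.ncard := by
  rw [numComp_eq_compCount, compCount_eq_ncard_compRep]
  exact Set.ncard_image_le (Set.toFinite _)

/-- For a connected graph, unmixedness of the binomial edge ideal is a condition on the cut
sets. -/
lemma isUnmixedIdeal_binomialEdgeIdeal_iff [Finite V] (hG : G.Connected) :
    IsUnmixedIdeal (binomialEdgeIdeal K G) ↔ ∀ S ∈ cutSets G, numComp G S = S.ncard + 1 := by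
  have hone : numComp G ∅ = 1 := by
    obtain ⟨u⟩ := hG.nonempty
    rw [numComp_eq_compCount, Set.compl_empty]
    exact compCount_eq_one (Set.mem_univ u) fun w _ => hG.connIn_univ u w
  have hpos : ∀ S : Set V, S.ncard + Sᶜ.ncard = Nat.card V := fun S => Set.ncard_add_ncard_compl S
  constructor
  · intro h S hS
    -- Comparison with the cut set ∅, whose prime has height |V| − 1.
    have := h _ (mem_minimalPrimes_binomialEdgeIdeal_iff.2 ⟨S, hS, rfl⟩) _
      (mem_minimalPrimes_binomialEdgeIdeal_iff.2 ⟨∅, empty_mem_cutSets, rfl⟩)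
    rw [height_componentIdeal, height_componentIdeal, Nat.cast_inj, hone, Set.ncard_empty] at this
    have h1 := hpos S
    have h2 := hpos ∅
    have h3 := numComp_le (G := G) (S := S)
    have h4 := numComp_le (G := G) (S := ∅)
    rw [Set.ncard_empty] at h2
    omega
  · intro h P hP Q hQ
    obtain ⟨S, hS, rfl⟩ := mem_minimalPrimes_binomialEdgeIdeal_iff.1 hP
    obtain ⟨T, hT, rfl⟩ := mem_minimalPrimes_binomialEdgeIdeal_iff.1 hQ
    rw [height_componentIdeal, height_componentIdeal, Nat.cast_inj, h S hS, h T hT]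
    have h1 := hpos S
    have h2 := hpos T
    have h3 := numComp_le (G := G) (S := S)
    have h4 := numComp_le (G := G) (S := T)
    have h5 := h S hS
    have h6 := h T hT
    omega

end

/-! ### Bipartite graphs and sets that isolate neighbours -/

/-- Every vertex of `S` has a neighbour all of whose neighbours lie in `S`. -/
def IsolatesNeighbors {V : Type*} (H : SimpleGraph V) (S : Set V) : Prop :=
  ∀ x ∈ S, ∃ y, H.Adj x y ∧ ∀ z, H.Adj y z → z ∈ S

/-- The vertices of `W` all of whose neighbours lie in `S`. -/
def isolatedVerts {V : Type*} (H : SimpleGraph V) (W S : Set V) : Set V :=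
  {y | y ∈ W ∧ ∀ z, H.Adj y z → z ∈ S}

/-- A connected bipartite graph with equal sides, each of whose cut sets `S` leaves `|S| + 1`
components. -/
structure IsBalancedUnmixed {V : Type*} (H : SimpleGraph V) (V₁ V₂ : Set V) : Prop where
  connected : H.Connected
  bipartite : H.IsBipartiteWith V₁ V₂
  cover : V₁ ∪ V₂ = Set.univ
  card : V₁.ncard = V₂.ncard
  unmixed : ∀ S ∈ cutSets H, numComp H S = S.ncard + 1

section

variable {V : Type*} {H : SimpleGraph V} {V₁ V₂ S : Set V} {x y z f : V}

lemma IsLeafVertex.eq (hx : IsLeafVertex H x) (hy : H.Adj x y) (hz : H.Adj x z) : y = z := by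
  obtain ⟨a, ha⟩ := Set.ncard_eq_one.1 hx
  have h1 : y ∈ H.neighborSet x := hy
  have h2 : z ∈ H.neighborSet x := hz
  rw [ha] at h1 h2
  exact h1.trans h2.symm

lemma IsLeafVertex.exists_adj (hx : IsLeafVertex H x) : ∃ y, H.Adj x y := by
  obtain ⟨a, ha⟩ := Set.ncard_eq_one.1 hx
  have : a ∈ H.neighborSet x := by rw [ha]; rfl
  exact ⟨a, this⟩

lemma exists_ne_adj_of_not_isLeafVertex (hx : ¬ IsLeafVertex H x) (hy : H.Adj x y) :
    ∃ z, H.Adj x z ∧ y ≠ z := by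
  by_contra! h
  refine hx (Set.ncard_eq_one.2 ⟨y, Set.ext fun z => ⟨fun hz => (h z hz).symm, ?_⟩⟩)
  rintro rfl
  exact hy

lemma IsLeafVertex.not_joinsIn {A : Set V} (hx : IsLeafVertex H x) : ¬ JoinsIn H A x := by
  rintro ⟨u, _, w, _, hu, hw, hn⟩
  rw [hx.eq hu hw] at hn
  exact hn (ConnIn.refl _)

lemma IsLeafVertex.notMem_of_mem_cutSets [Finite V] (hx : IsLeafVertex H x) (hS : S ∈ cutSets H) :
    x ∉ S :=
  fun h => hx.not_joinsIn (mem_cutSets_iff.1 hS x h)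

lemma mem_right_of_adj (hb : H.IsBipartiteWith V₁ V₂) (hx : x ∈ V₁) (h : H.Adj x y) : y ∈ V₂ := by
  rcases hb.mem_of_adj h with h' | h'
  · exact h'.2
  · exact absurd h'.1 (Set.disjoint_left.1 hb.disjoint hx)

lemma not_adj_of_mem (hb : H.IsBipartiteWith V₁ V₂) (hx : x ∈ V₂) (hy : y ∈ V₂) : ¬ H.Adj x y :=
  fun h => Set.disjoint_left.1 hb.disjoint (mem_right_of_adj hb.symm hx h) hy

/-- A walk inside `A` stays in its component. -/
lemma ConnIn.restrict {A : Set V} {u w : V} (h : ConnIn H A u w) :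
    ConnIn H {z | ConnIn H A u z} u w := by
  refine (h.induct (fun z => ConnIn H A u z ∧ ConnIn H {z | ConnIn H A u z} u z) ?_
    ⟨ConnIn.refl _, ConnIn.refl _⟩).2
  rintro a ha b hb hab ⟨h1, h2⟩
  have h3 := h1.trans (ConnIn.of_adj ha hb hab)
  exact ⟨h3, h2.trans (ConnIn.of_adj h1 h3 hab)⟩

lemma compCount_component {A : Set V} {u : V} : compCount H {z | ConnIn H A u z} = 1 :=
  compCount_eq_one (u := u) (ConnIn.refl u) fun _ hw => ConnIn.restrict hw

/-- A non-leaf x of S has a neighbour y with N(y) ⊆ S and a second neighbour z. Once the non-leaves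
of S are removed, y keeps only pendant leaves, so z is not in its component. -/
lemma IsolatesNeighbors.diff_leaves_mem_cutSets [Finite V] (hS : IsolatesNeighbors H S)
    (hb : H.IsBipartiteWith V₁ V₂) (hSV : S ⊆ V₁) :
    S \ {x | IsLeafVertex H x} ∈ cutSets H := by
  rw [mem_cutSets_iff]
  rintro x ⟨hxS, hxl⟩
  obtain ⟨y, hxy, hy⟩ := hS x hxS
  obtain ⟨z, hxz, hyz⟩ := exists_ne_adj_of_not_isLeafVertex hxl hxy
  have hyV := mem_right_of_adj hb (hSV hxS) hxy
  have hzV := mem_right_of_adj hb (hSV hxS) hxz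
  have hc : ∀ a ∈ V₂, a ∈ (S \ {x | IsLeafVertex H x})ᶜ :=
    fun a ha h => Set.disjoint_left.1 hb.disjoint (hSV h.1) ha
  refine ⟨y, hc y hyV, z, hc z hzV, hxy, hxz,
    not_connIn_of_pendant hyz (not_adj_of_mem hb hyV hzV) ?_⟩
  intro a ha hya b _ hab
  have hl : IsLeafVertex H a := by
    by_contra h
    exact ha ⟨hy a hya, h⟩
  exact hl.eq hab hya.symm

/-- The leaves in S hang off isolated vertices, so each isolated vertex is the centre of a star
component; no edge joins these stars to the rest. -/
lemma IsolatesNeighbors.compCount_diff_leaves [Finite V] (hS : IsolatesNeighbors H S)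
    (hb : H.IsBipartiteWith V₁ V₂) (hSV : S ⊆ V₁) :
    compCount H (S \ {x | IsLeafVertex H x})ᶜ =
      (isolatedVerts H V₂ S).ncard + compCount H (S ∪ isolatedVerts H V₂ S)ᶜ := by
  have hdis : Disjoint S (isolatedVerts H V₂ S) := by
    rw [Set.disjoint_left]
    exact fun a ha h => Set.disjoint_left.1 hb.disjoint (hSV ha) h.1
  have heq : (S \ {x | IsLeafVertex H x})ᶜ =
      (isolatedVerts H V₂ S ∪ (S ∩ {x | IsLeafVertex H x})) ∪ (S ∪ isolatedVerts H V₂ S)ᶜ := by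
    ext a
    have h : a ∈ S → a ∉ isolatedVerts H V₂ S := fun h => Set.disjoint_left.1 hdis h
    generalize isolatedVerts H V₂ S = Y at h
    generalize {x | IsLeafVertex H x} = L
    simp only [Set.mem_compl_iff, Set.mem_sdiff, Set.mem_union, Set.mem_inter_iff]
    tauto
  have hpend : ∀ b ∈ S ∩ {x | IsLeafVertex H x},
      ∃ a ∈ isolatedVerts H V₂ S, H.Adj b a ∧ ∀ z, H.Adj b z → z = a := by
    rintro b ⟨hbS, hbl⟩
    obtain ⟨y, hby, hy⟩ := hS b hbS
    exact ⟨y, ⟨mem_right_of_adj hb (hSV hbS) hby, hy⟩, hby, fun z hz => IsLeafVertex.eq hbl hz hby⟩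
  rw [heq, compCount_union, compCount_union_of_pendant _ _ hpend]
  · exact fun a ha c hc => not_adj_of_mem hb ha.1 hc.1
  · exact hdis.symm.mono_right Set.inter_subset_left
  · rw [Set.disjoint_left]
    rintro a (ha | ha) h
    · exact h (Or.inr ha)
    · exact h (Or.inl ha.1)
  · rintro a (ha | ha) c hc hac
    · exact hc (Or.inl (ha.2 c hac))
    · obtain ⟨y, hy, _, hz⟩ := hpend a ha
      exact hc (Or.inr (hz c hac ▸ hy))

end

/-! ### Leaves and cut sets of balanced unmixed bipartite graphs -/

namespace IsBalancedUnmixed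

variable {V : Type*} {H : SimpleGraph V} {V₁ V₂ S : Set V} {x y z f : V}

lemma symm (hH : IsBalancedUnmixed H V₁ V₂) : IsBalancedUnmixed H V₂ V₁ :=
  ⟨hH.connected, hH.bipartite.symm, by rw [Set.union_comm, hH.cover], hH.card.symm, hH.unmixed⟩

lemma mem_or (hH : IsBalancedUnmixed H V₁ V₂) (x : V) : x ∈ V₁ ∨ x ∈ V₂ := by
  have : x ∈ V₁ ∪ V₂ := hH.cover ▸ Set.mem_univ x
  exact this

lemma notMem_of_mem (hH : IsBalancedUnmixed H V₁ V₂) (hx : x ∈ V₁) : x ∉ V₂ :=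
  Set.disjoint_left.1 hH.bipartite.disjoint hx

lemma left_nonempty [Finite V] (hH : IsBalancedUnmixed H V₁ V₂) : V₁.Nonempty := by
  obtain ⟨a⟩ := hH.connected.nonempty
  rcases hH.mem_or a with h | h
  · exact ⟨a, h⟩
  · rw [← Set.ncard_pos, hH.card, Set.ncard_pos]
    exact ⟨a, h⟩

lemma exists_adj [Finite V] (hH : IsBalancedUnmixed H V₁ V₂) (x : V) : ∃ y, H.Adj x y := by
  obtain ⟨a, ha⟩ := hH.left_nonempty
  obtain ⟨b, hb⟩ := hH.symm.left_nonempty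
  by_contra! h
  have key : ∀ c, x = c := fun c =>
    (hH.connected.connIn_univ x c).induct (fun z => x = z)
      (fun d _ e _ hde hd => absurd hde (hd ▸ h e)) rfl
  exact hH.notMem_of_mem ha ((key a).symm.trans (key b) ▸ hb)

/-- The component count for the cut set obtained from a set that isolates neighbours. -/
lemma ncard_isolatedVerts_add [Finite V] (hH : IsBalancedUnmixed H V₁ V₂)
    (hS : IsolatesNeighbors H S) (hSV : S ⊆ V₁) :
    (isolatedVerts H V₂ S).ncard + compCount H (S ∪ isolatedVerts H V₂ S)ᶜ =
      (S \ {x | IsLeafVertex H x}).ncard + 1 := by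
  rw [← hS.compCount_diff_leaves hH.bipartite hSV]
  exact hH.unmixed _ (hS.diff_leaves_mem_cutSets hH.bipartite hSV)

lemma isolatesNeighbors_left [Finite V] (hH : IsBalancedUnmixed H V₁ V₂) :
    IsolatesNeighbors H V₁ := by
  intro x hx
  obtain ⟨y, hy⟩ := hH.exists_adj x
  have hy2 := mem_right_of_adj hH.bipartite hx hy
  exact ⟨y, hy, fun z hz => mem_right_of_adj hH.bipartite.symm hy2 hz⟩

lemma isolatedVerts_left (hH : IsBalancedUnmixed H V₁ V₂) : isolatedVerts H V₂ V₁ = V₂ :=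
  Set.ext fun _ => ⟨fun h => h.1, fun hy =>
    ⟨hy, fun _ hz => mem_right_of_adj hH.bipartite.symm hy hz⟩⟩

/-- Each side contains exactly one leaf. -/
lemma exists_unique_leaf [Finite V] (hH : IsBalancedUnmixed H V₁ V₂) :
    ∃ f, f ∈ V₁ ∧ IsLeafVertex H f ∧ ∀ x ∈ V₁, IsLeafVertex H x → x = f := by
  -- S = V₁ isolates all of V₂ and leaves nothing else, so |V₂| = |V₁ minus leaves| + 1.
  have h := hH.ncard_isolatedVerts_add hH.isolatesNeighbors_left subset_rfl
  rw [hH.isolatedVerts_left, hH.cover, Set.compl_univ, compCount_empty] at h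
  have h2 := Set.ncard_inter_add_ncard_sdiff_eq_ncard V₁ {x | IsLeafVertex H x}
  have h3 := hH.card
  have h4 : (V₁ ∩ {x | IsLeafVertex H x}).ncard = 1 := by omega
  obtain ⟨f, hf⟩ := Set.ncard_eq_one.1 h4
  have hf' : f ∈ V₁ ∩ {x | IsLeafVertex H x} := by rw [hf]; rfl
  refine ⟨f, hf'.1, hf'.2, fun x hx hl => ?_⟩
  have : x ∈ V₁ ∩ {x | IsLeafVertex H x} := ⟨hx, hl⟩
  rw [hf] at this
  exact this

lemma diff_leaves_eq [Finite V] (hH : IsBalancedUnmixed H V₁ V₂) (hSV : S ⊆ V₁) (hf : f ∈ V₁)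
    (hl : IsLeafVertex H f) : S \ {x | IsLeafVertex H x} = S \ {f} := by
  obtain ⟨f', hf', hl', hu⟩ := hH.exists_unique_leaf
  ext x
  simp only [Set.mem_sdiff, Set.mem_ofPred_eq, Set.mem_singleton_iff]
  refine and_congr_right fun hx => not_congr ⟨fun h => ?_, fun h => h ▸ hl⟩
  rw [hu x (hSV hx) h, hu f hf hl]

lemma ncard_isolatedVerts_add_of_leaf_notMem [Finite V] (hH : IsBalancedUnmixed H V₁ V₂)
    (hS : IsolatesNeighbors H S) (hSV : S ⊆ V₁) (hf : f ∈ V₁) (hl : IsLeafVertex H f)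
    (hfS : f ∉ S) :
    (isolatedVerts H V₂ S).ncard + compCount H (S ∪ isolatedVerts H V₂ S)ᶜ = S.ncard + 1 := by
  rw [hH.ncard_isolatedVerts_add hS hSV, hH.diff_leaves_eq hSV hf hl,
    Set.sdiff_singleton_eq_self hfS]

lemma ncard_isolatedVerts_add_of_leaf_mem [Finite V] (hH : IsBalancedUnmixed H V₁ V₂)
    (hS : IsolatesNeighbors H S) (hSV : S ⊆ V₁) (hl : IsLeafVertex H f) (hfS : f ∈ S) :
    (isolatedVerts H V₂ S).ncard + compCount H (S ∪ isolatedVerts H V₂ S)ᶜ = S.ncard := by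
  rw [hH.ncard_isolatedVerts_add hS hSV, hH.diff_leaves_eq hSV (hSV hfS) hl,
    Set.ncard_sdiff_singleton_add_one hfS]

lemma mem_cutSets_of_leaf_notMem [Finite V] (hH : IsBalancedUnmixed H V₁ V₂)
    (hS : IsolatesNeighbors H S) (hSV : S ⊆ V₁) (hf : f ∈ V₁) (hl : IsLeafVertex H f)
    (hfS : f ∉ S) : S ∈ cutSets H := by
  have := hS.diff_leaves_mem_cutSets hH.bipartite hSV
  rwa [hH.diff_leaves_eq hSV hf hl, Set.sdiff_singleton_eq_self hfS] at this

/-- With the leaf in S the count reads |Y| + c(rest) = |S|, so |S| ≤ |Y| leaves no room for a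
remaining component. -/
lemma eq_left_of_ncard_le [Finite V] (hH : IsBalancedUnmixed H V₁ V₂)
    (hS : IsolatesNeighbors H S) (hSV : S ⊆ V₁) (hl : IsLeafVertex H f) (hfS : f ∈ S)
    (hcard : S.ncard ≤ (isolatedVerts H V₂ S).ncard) : S = V₁ := by
  have h := hH.ncard_isolatedVerts_add_of_leaf_mem hS hSV hl hfS
  refine Set.Subset.antisymm hSV fun x hx => ?_
  by_contra hxS
  have : 0 < compCount H (S ∪ isolatedVerts H V₂ S)ᶜ := by
    refine compCount_pos ⟨x, ?_⟩
    rintro (h | h)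
    · exact hxS h
    · exact hH.notMem_of_mem hx h.1
  omega

/-- If the neighbours of the leaves are adjacent, a subset of `V₁` that isolates neighbours and
contains the leaf of `V₁` is all of `V₁`. -/
lemma eq_left_of_leaf_mem [Finite V] (hH : IsBalancedUnmixed H V₁ V₂)
    (hadj : LeafNeighborsAdjacent H) (hS : IsolatesNeighbors H S) (hSV : S ⊆ V₁)
    (hl : IsLeafVertex H f) (hfS : f ∈ S) : S = V₁ := by
  obtain ⟨f₂, hf₂, hl₂, -⟩ := hH.symm.exists_unique_leaf
  have hb := hH.bipartite
  set A : Set V := S ∪ isolatedVerts H V₂ S with hA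
  -- Passing to the part of S in the component of `f` makes S₀ together with its isolated vertices
  -- connected, so that the complementary count on the other side involves a single component.
  set S₀ : Set V := {x | x ∈ S ∧ ConnIn H A f x} with hS₀
  have hS₀V : S₀ ⊆ V₁ := fun x hx => hSV hx.1
  have hfS₀ : f ∈ S₀ := ⟨hfS, ConnIn.refl _⟩
  -- neighbours of isolated vertices adjacent to `S₀` are in `S₀`
  have hstep : ∀ x ∈ S₀, ∀ y ∈ isolatedVerts H V₂ S, H.Adj x y → y ∈ isolatedVerts H V₂ S₀ := by
    rintro x ⟨hx, hfx⟩ y hy hxy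
    refine ⟨hy.1, fun z hz => ⟨hy.2 z hz, ?_⟩⟩
    exact hfx.trans ((ConnIn.of_adj (A := A) (Or.inl hx) (Or.inr hy) hxy).trans
      (ConnIn.of_adj (A := A) (Or.inr hy) (Or.inl (hy.2 z hz)) hz))
  have hiso : IsolatesNeighbors H S₀ := by
    intro x hx
    obtain ⟨y, hxy, hy⟩ := hS x hx.1
    exact ⟨y, hxy, (hstep x hx y ⟨mem_right_of_adj hb (hS₀V hx) hxy, hy⟩ hxy).2⟩
  have hconn : compCount H (S₀ ∪ isolatedVerts H V₂ S₀) = 1 := by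
    have h1 : ∀ x ∈ S₀, ConnIn H (S₀ ∪ isolatedVerts H V₂ S₀) f x := by
      intro x hx
      refine (hx.2.induct (fun z => z ∈ S₀ ∪ isolatedVerts H V₂ S₀ ∧
        ConnIn H (S₀ ∪ isolatedVerts H V₂ S₀) f z) ?_ ⟨Or.inl hfS₀, ConnIn.refl _⟩).2
      rintro a _ b hbA hab ⟨ha, hfa⟩
      have hb' : b ∈ S₀ ∪ isolatedVerts H V₂ S₀ := by
        rcases ha with ha | ha
        · have hbV := mem_right_of_adj hb (hS₀V ha) hab
          refine Or.inr (hstep a ha b (hbA.resolve_left fun h => ?_) hab)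
          exact hH.notMem_of_mem (hSV h) hbV
        · exact Or.inl (ha.2 b hab)
      exact ⟨hb', hfa.trans (ConnIn.of_adj ha hb' hab)⟩
    refine compCount_eq_one (Or.inl hfS₀) ?_
    rintro w (hw | hw)
    · exact h1 w hw
    · obtain ⟨x, hx⟩ := hH.exists_adj w
      exact (h1 x (hw.2 x hx)).trans (ConnIn.of_adj (Or.inl (hw.2 x hx)) (Or.inr hw) hx.symm)
  have hYV : isolatedVerts H V₂ S₀ ⊆ V₂ := fun y hy => hy.1
  have hisoT : IsolatesNeighbors H (V₂ \ isolatedVerts H V₂ S₀) := by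
    rintro y ⟨hy, hyn⟩
    have : ∃ x, H.Adj y x ∧ x ∉ S₀ := by
      by_contra! h
      exact hyn ⟨hy, h⟩
    obtain ⟨x, hyx, hx⟩ := this
    refine ⟨x, hyx, fun z hz => ⟨?_, fun hzY => hx (hzY.2 x hz.symm)⟩⟩
    exact mem_right_of_adj hb (mem_right_of_adj hb.symm hy hyx) hz
  have hisoV : isolatedVerts H V₁ (V₂ \ isolatedVerts H V₂ S₀) = V₁ \ S₀ := by
    ext x
    constructor
    · rintro ⟨hx, hn⟩
      refine ⟨hx, fun hxS => ?_⟩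
      obtain ⟨y, hxy, hy⟩ := hiso x hxS
      exact (hn y hxy).2 ⟨(hn y hxy).1, hy⟩
    · rintro ⟨hx, hxS⟩
      exact ⟨hx, fun z hz => ⟨mem_right_of_adj hb hx hz, fun hzY => hxS (hzY.2 x hz.symm)⟩⟩
  -- The only use of the adjacency hypothesis: N(g) ⊆ S₀ contains the neighbour `h` of `f₂`. Hence
  -- V₂ minus the isolated vertices misses the leaf `f₂`.
  have hf₂Y : f₂ ∈ isolatedVerts H V₂ S₀ := by
    obtain ⟨g, hfg, hg⟩ := hiso f hfS₀
    obtain ⟨h, hfh⟩ := hl₂.exists_adj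
    have hne : f ≠ f₂ := fun h => hH.notMem_of_mem (hSV hfS) (h ▸ hf₂)
    refine ⟨hf₂, fun z hz => ?_⟩
    rw [hl₂.eq hz hfh]
    exact hg h (hadj f f₂ g h hl hl₂ hne hfg hfh)
  have hE := hH.symm.ncard_isolatedVerts_add_of_leaf_notMem hisoT Set.sdiff_subset hf₂ hl₂
    fun h => h.2 hf₂Y
  have hcompl : (V₂ \ isolatedVerts H V₂ S₀ ∪ V₁ \ S₀)ᶜ = S₀ ∪ isolatedVerts H V₂ S₀ := by
    ext a
    have h1 := hH.mem_or a
    have h2 := hH.notMem_of_mem (x := a)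
    have h3 := @hS₀V a
    have h4 := @hYV a
    simp only [Set.mem_compl_iff, Set.mem_union, Set.mem_sdiff]
    tauto
  rw [hisoV, hcompl, hconn, Set.ncard_sdiff hS₀V, Set.ncard_sdiff hYV] at hE
  have h1 := Set.ncard_le_ncard hS₀V
  have h2 := Set.ncard_le_ncard hYV
  have h3 := hH.card
  -- The count `hE` reads |V₁ \ S₀| + 1 = |V₂ \ Y(S₀)| + 1, that is |S₀| = |Y(S₀)|.
  have h4 : S₀ = V₁ := hH.eq_left_of_ncard_le hiso hS₀V hl hfS₀ (by omega)
  exact Set.Subset.antisymm hSV fun x hx => (h4 ▸ hx : x ∈ S₀).1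

/-- If the neighbours of the leaves are adjacent and `S ⊆ V₁` is a cut set, all vertices outside `S`
that are not isolated by `S` are connected to the leaf of `V₁`. -/
lemma connIn_leaf [Finite V] (hH : IsBalancedUnmixed H V₁ V₂)
    (hadj : LeafNeighborsAdjacent H) (hS : S ∈ cutSets H) (hSV : S ⊆ V₁)
    (hf : f ∈ V₁) (hl : IsLeafVertex H f) {u : V} (huS : u ∉ S)
    (huY : u ∉ isolatedVerts H V₂ S) : ConnIn H Sᶜ f u := by
  by_contra hfu
  obtain ⟨f₂, hf₂, hl₂, hu₂⟩ := hH.symm.exists_unique_leaf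
  obtain ⟨f', _, _, hu₁⟩ := hH.exists_unique_leaf
  obtain rfl := hu₁ f hf hl
  obtain ⟨g, hfg⟩ := hl.exists_adj
  obtain ⟨h, hfh⟩ := hl₂.exists_adj
  have hb := hH.bipartite
  have hne : f ≠ f₂ := fun h => hH.notMem_of_mem hf (h ▸ hf₂)
  have hgh : H.Adj g h := hadj f f₂ g h hl hl₂ hne hfg hfh
  have hfS : f ∉ S := hl.notMem_of_mem_cutSets hS
  have hSV₂ : ∀ a ∈ V₂, a ∉ S := fun a ha h => hH.notMem_of_mem (hSV h) ha
  have hgV : g ∈ V₂ := mem_right_of_adj hb hf hfg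
  -- the component `B` of `u` and its two sides
  set B : Set V := {z | ConnIn H Sᶜ u z} with hB
  have huB : u ∈ B := ConnIn.refl _
  have hBS : ∀ a ∈ B, a ∉ S := fun a ha => ConnIn.mem (A := Sᶜ) ha huS
  have hBcl : ∀ a ∈ B, ∀ b, b ∉ S → H.Adj a b → b ∈ B := fun a ha b hb' hab =>
    ConnIn.trans ha (ConnIn.of_adj (A := Sᶜ) (hBS a ha) hb' hab)
  have hfB : f ∉ B := fun h => hfu h.symm
  have hgB : g ∉ B := fun h' => hfB (hBcl g h' f hfS hfg.symm)
  have hhB : h ∉ B := fun h' => hgB (hBcl h h' g (hSV₂ g hgV) hgh.symm)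
  set P : Set V := B ∩ V₁ with hP
  set Q : Set V := B ∩ V₂ with hQ
  have hPnbr : ∀ x ∈ P, ∀ z, H.Adj x z → z ∈ Q := fun x hx z hz =>
    ⟨hBcl x hx.1 z (hSV₂ z (mem_right_of_adj hb hx.2 hz)) hz, mem_right_of_adj hb hx.2 hz⟩
  have hQnbr : ∀ y ∈ Q, ∃ x ∈ P, H.Adj y x := by
    intro y hy
    by_contra! hc
    have hN : ∀ z, H.Adj y z → z ∈ S := by
      intro z hz
      by_contra hzS
      exact hc z ⟨hBcl y hy.1 z hzS hz, mem_right_of_adj hb.symm hy.2 hz⟩ hz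
    have : y = u := (ConnIn.symm hy.1).induct (fun z => y = z)
      (fun a _ b hb' hab hya => absurd (hN b (hya ▸ hab)) hb') rfl
    exact huY (this ▸ ⟨hy.2, hN⟩)
  have hSQ : ∀ x ∈ S, ∃ z, H.Adj x z ∧ z ∉ Q := by
    intro x hx
    by_contra! hc
    obtain ⟨a, _, b, _, hxa, hxb, hn⟩ := mem_cutSets_iff.1 hS x hx
    exact hn ((ConnIn.symm (hc a hxa).1).trans (hc b hxb).1)
  have hf₂B : f₂ ∉ B := by
    intro h'
    obtain ⟨x, hx, hfx⟩ := hQnbr f₂ ⟨h', hf₂⟩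
    rw [hl₂.eq hfx hfh] at hx
    exact hhB hx.1
  -- cutting along `S ∪ P`
  have hSP : S ∪ P ∈ cutSets H := by
    rw [mem_cutSets_iff]
    have hc : ∀ a ∈ V₂, a ∈ (S ∪ P)ᶜ := by
      rintro a ha (h' | h')
      · exact hSV₂ a ha h'
      · exact hH.notMem_of_mem h'.2 ha
    rintro x (hx | hx)
    · obtain ⟨a, _, b, _, hxa, hxb, hn⟩ := mem_cutSets_iff.1 hS x hx
      exact ⟨a, hc a (mem_right_of_adj hb (hSV hx) hxa), b,
        hc b (mem_right_of_adj hb (hSV hx) hxb), hxa, hxb,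
        fun h' => hn (h'.mono (Set.compl_subset_compl.2 Set.subset_union_left))⟩
    · have hxl : ¬ IsLeafVertex H x := fun h' => hfB (hu₁ x hx.2 h' ▸ hx.1)
      obtain ⟨y, hxy⟩ := hH.exists_adj x
      obtain ⟨z, hxz, hyz⟩ := exists_ne_adj_of_not_isLeafVertex hxl hxy
      have hyQ := hPnbr x hx y hxy
      have hzQ := hPnbr x hx z hxz
      refine ⟨y, hc y hyQ.2, z, hc z hzQ.2, hxy, hxz,
        not_connIn_of_pendant hyz (not_adj_of_mem hb hyQ.2 hzQ.2) ?_⟩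
      intro a ha hya
      exact absurd (Or.inr ⟨hBcl y hyQ.1 a (fun h' => ha (Or.inl h')) hya,
        mem_right_of_adj hb.symm hyQ.2 hya⟩) ha
  -- Passing from S to S ∪ P replaces the one component B by the |Q| isolated vertices of Q, while
  -- unmixedness makes the count grow by |P|.
  have hQP : Q.ncard = P.ncard + 1 := by
    have hdBR : Disjoint B (S ∪ B)ᶜ := by
      rw [Set.disjoint_left]
      exact fun a ha h' => h' (Or.inr ha)
    have hBR : ∀ a ∈ B, ∀ b ∈ (S ∪ B)ᶜ, ¬ H.Adj a b := fun a ha b hb' hab =>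
      hb' (Or.inr (hBcl a ha b (fun h' => hb' (Or.inl h')) hab))
    have hQB : Q ⊆ B := Set.inter_subset_left
    have h1 : Sᶜ = B ∪ (S ∪ B)ᶜ := by
      ext a
      have := hBS a
      simp only [Set.mem_compl_iff, Set.mem_union]
      tauto
    have h2 : (S ∪ P)ᶜ = Q ∪ (S ∪ B)ᶜ := by
      ext a
      have h3 := hBS a
      have h4 := hH.mem_or a
      have h5 := hH.notMem_of_mem (x := a)
      simp only [hP, hQ, Set.mem_compl_iff, Set.mem_union, Set.mem_inter_iff]
      tauto
    have h3 := hH.unmixed _ hSP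
    have h4 := hH.unmixed _ hS
    rw [numComp_eq_compCount, h1, compCount_union hdBR hBR, compCount_component] at h4
    rw [numComp_eq_compCount, h2, compCount_union (hdBR.mono_left hQB)
      (fun a ha => hBR a (hQB ha)),
      compCount_of_indep fun a ha c hc => not_adj_of_mem hb ha.2 hc.2, Set.ncard_union_eq] at h3
    · omega
    · rw [Set.disjoint_left]
      exact fun a ha h' => hBS a h'.1 ha
  -- the part `C` outside `B` that is not connected to the leaf
  set C' : Set V := {z | ConnIn H Bᶜ f z} with hC'
  have hC'B : ∀ a ∈ C', a ∉ B := fun a ha => ConnIn.mem (A := Bᶜ) ha hfB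
  set C : Set V := {z | z ∉ B ∧ z ∉ C'} with hC
  have hCcl : ∀ a ∈ C, ∀ b, b ∉ B → H.Adj a b → b ∈ C := fun a ha b hb' hab =>
    ⟨hb', fun h' => ha.2 (ConnIn.trans h' (ConnIn.of_adj (A := Bᶜ) hb' ha.1 hab.symm))⟩
  have hfC' : f ∈ C' := ConnIn.refl _
  have hf₂C' : f₂ ∈ C' :=
    (ConnIn.of_adj (A := Bᶜ) hfB hgB hfg).trans ((ConnIn.of_adj (A := Bᶜ) hgB hhB hgh).trans
      (ConnIn.of_adj (A := Bᶜ) hhB hf₂B hfh.symm))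
  have hCnbr₂ : ∀ y ∈ C, y ∈ V₂ → ∀ z, H.Adj y z → z ∈ C ∧ z ∈ V₁ := by
    intro y hy hyV z hz
    have hzV := mem_right_of_adj hb.symm hyV hz
    exact ⟨hCcl y hy z (fun h' => hy.1 (hPnbr z ⟨h', hzV⟩ y hz.symm).1) hz, hzV⟩
  -- For x in S this is `hSQ`. It prevents Q alone from isolating any vertex of V₁ outside B.
  have hoff : ∀ x ∈ V₁, x ∉ B → ∃ z, H.Adj x z ∧ z ∉ Q := by
    intro x hx hxB
    by_cases hxS : x ∈ S
    · exact hSQ x hxS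
    · obtain ⟨z, hz⟩ := hH.exists_adj x
      exact ⟨z, hz, fun h' => hxB (hBcl z h'.1 x hxS hz.symm)⟩
  have hCnbr₁ : ∀ x ∈ C, x ∈ V₁ → ∃ y ∈ C, y ∈ V₂ ∧ H.Adj x y := by
    intro x hx hxV
    obtain ⟨z, hz, hzQ⟩ := hoff x hxV hx.1
    have hzV := mem_right_of_adj hb hxV hz
    exact ⟨z, hCcl x hx z (fun h' => hzQ ⟨h', hzV⟩) hz, hzV, hz⟩
  have hsplit : ∀ a, a ∈ B ∨ a ∈ C ∨ a ∈ C' := by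
    intro a
    by_cases h1 : a ∈ B
    · exact Or.inl h1
    by_cases h2 : a ∈ C'
    · exact Or.inr (Or.inr h2)
    · exact Or.inr (Or.inl ⟨h1, h2⟩)
  -- cutting along `Q ∪ (C ∩ V₂)`
  have hcard₁ : (C ∩ V₁).ncard = (C ∩ V₂).ncard + 1 := by
    have hiso : IsolatesNeighbors H (Q ∪ C ∩ V₂) := by
      rintro y (hy | hy)
      · obtain ⟨x, hx, hyx⟩ := hQnbr y hy
        exact ⟨x, hyx, fun z hz => Or.inl (hPnbr x hx z hz)⟩
      · obtain ⟨x, hyx⟩ := hH.exists_adj y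
        obtain ⟨hxC, hxV⟩ := hCnbr₂ y hy.1 hy.2 x hyx
        refine ⟨x, hyx, fun z hz => ?_⟩
        have hzV := mem_right_of_adj hb hxV hz
        by_cases hzB : z ∈ B
        · exact Or.inl ⟨hzB, hzV⟩
        · exact Or.inr ⟨hCcl x hxC z hzB hz, hzV⟩
    have hY : isolatedVerts H V₁ (Q ∪ C ∩ V₂) = P ∪ C ∩ V₁ := by
      ext x
      constructor
      · rintro ⟨hx, hN⟩
        by_cases hxB : x ∈ B
        · exact Or.inl ⟨hxB, hx⟩
        · obtain ⟨z, hz, hzQ⟩ := hoff x hx hxB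
          exact Or.inr ⟨hCcl z ((hN z hz).resolve_left hzQ).1 x hxB hz.symm, hx⟩
      · rintro (hx | hx)
        · exact ⟨hx.2, fun z hz => Or.inl (hPnbr x hx z hz)⟩
        · refine ⟨hx.2, fun z hz => ?_⟩
          have hzV := mem_right_of_adj hb hx.2 hz
          by_cases hzB : z ∈ B
          · exact Or.inl ⟨hzB, hzV⟩
          · exact Or.inr ⟨hCcl x hx.1 z hzB hz, hzV⟩
    -- Only the connected set C' remains, so |P| + |C ∩ V₁| + 1 = |Q| + |C ∩ V₂| + 1; with |Q| = |P|
    -- + 1 the two sides of C differ by one.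
    have hE := hH.symm.ncard_isolatedVerts_add_of_leaf_notMem hiso
      (Set.union_subset Set.inter_subset_right Set.inter_subset_right) hf₂ hl₂ (by
        rintro (h' | h')
        · exact hf₂B h'.1
        · exact h'.1.2 hf₂C')
    have hcompl : (Q ∪ C ∩ V₂ ∪ (P ∪ C ∩ V₁))ᶜ = C' := by
      ext a
      constructor
      · intro ha
        rcases hsplit a with h1 | h1 | h1
        · rcases hH.mem_or a with h2 | h2
          · exact absurd (Or.inr (Or.inl ⟨h1, h2⟩)) ha
          · exact absurd (Or.inl (Or.inl ⟨h1, h2⟩)) ha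
        · rcases hH.mem_or a with h2 | h2
          · exact absurd (Or.inr (Or.inr ⟨h1, h2⟩)) ha
          · exact absurd (Or.inl (Or.inr ⟨h1, h2⟩)) ha
        · exact h1
      · rintro ha ((h1 | h1) | (h1 | h1))
        · exact hC'B a ha h1.1
        · exact h1.1.2 ha
        · exact hC'B a ha h1.1
        · exact h1.1.2 ha
    have hBC : Disjoint B C := by
      rw [Set.disjoint_left]
      exact fun a ha h' => h'.1 ha
    rw [hY, hcompl, compCount_component, Set.ncard_union_eq, Set.ncard_union_eq] at hE
    · omega
    · exact hBC.mono Set.inter_subset_left Set.inter_subset_left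
    · exact hBC.mono Set.inter_subset_left Set.inter_subset_left
  -- cutting along `C ∩ V₁`
  have hiso : IsolatesNeighbors H (C ∩ V₁) := by
    rintro x ⟨hx, hxV⟩
    obtain ⟨y, hy, hyV, hxy⟩ := hCnbr₁ x hx hxV
    exact ⟨y, hxy, fun z hz => hCnbr₂ y hy hyV z hz⟩
  have hY : isolatedVerts H V₂ (C ∩ V₁) = C ∩ V₂ := by
    ext y
    constructor
    · rintro ⟨hyV, hN⟩
      obtain ⟨z, hz⟩ := hH.exists_adj y
      refine ⟨hCcl z (hN z hz).1 y (fun hyB => ?_) hz.symm, hyV⟩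
      obtain ⟨x, hx, hyx⟩ := hQnbr y ⟨hyB, hyV⟩
      exact (hN x hyx).1.1 hx.1
    · exact fun hy => ⟨hy.2, hCnbr₂ y hy.1 hy.2⟩
  have hE := hH.ncard_isolatedVerts_add_of_leaf_notMem hiso Set.inter_subset_right hf hl
    fun h' => h'.1.2 hfC'
  have hcompl : C ∩ V₁ ∪ C ∩ V₂ = C := by
    rw [← Set.inter_union_distrib_left, hH.cover, Set.inter_univ]
  -- A walk of H leaving C must enter B, which is connected to `u`. The count for C ∩ V₁ then gives
  -- |C ∩ V₂| = |C ∩ V₁|, contradicting `hcard₁`.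
  have hone : compCount H Cᶜ = 1 := by
    have huC : u ∈ Cᶜ := fun h' => h'.1 huB
    refine compCount_eq_one huC fun w hw => ?_
    refine (hH.connected.connIn_univ u w).induct (fun z => z ∈ Cᶜ → ConnIn H Cᶜ u z) ?_
      (fun _ => ConnIn.refl _) hw
    intro a _ b _ hab iha hbC
    by_cases ha : a ∈ C
    · have hbB : b ∈ B := by
        by_contra hbB
        exact hbC (hCcl a ha b hbB hab)
      exact (ConnIn.restrict hbB).mono fun z hz h' => h'.1 hz
    · exact (iha ha).trans (ConnIn.of_adj ha hbC hab)
  rw [hY, hcompl, hone] at hE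
  omega

/-- If the neighbours of the leaves are adjacent, a cut set `S ⊆ V₁` isolates neighbours, and it
isolates exactly `|S|` vertices. -/
lemma isolatesNeighbors_of_mem_cutSets [Finite V] (hH : IsBalancedUnmixed H V₁ V₂)
    (hadj : LeafNeighborsAdjacent H) (hS : S ∈ cutSets H) (hSV : S ⊆ V₁) :
    IsolatesNeighbors H S ∧ (isolatedVerts H V₂ S).ncard = S.ncard := by
  obtain ⟨f, hf, hl, -⟩ := hH.exists_unique_leaf
  have hfS : f ∉ S := hl.notMem_of_mem_cutSets hS
  have hiso : IsolatesNeighbors H S := by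
    intro x hx
    obtain ⟨a, ha, b, hb', hxa, hxb, hn⟩ := mem_cutSets_iff.1 hS x hx
    -- Of two neighbours of `x` in different components, at most one lies in the component of the
    -- leaf; the other must be isolated.
    by_cases haY : a ∈ isolatedVerts H V₂ S
    · exact ⟨a, hxa, haY.2⟩
    by_cases hbY : b ∈ isolatedVerts H V₂ S
    · exact ⟨b, hxb, hbY.2⟩
    exact absurd ((hH.connIn_leaf hadj hS hSV hf hl ha haY).symm.trans
      (hH.connIn_leaf hadj hS hSV hf hl hb' hbY)) hn
  refine ⟨hiso, ?_⟩
  have hE := hH.ncard_isolatedVerts_add_of_leaf_notMem hiso hSV hf hl hfS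
  have hfY : f ∈ (S ∪ isolatedVerts H V₂ S)ᶜ := by
    rintro (h | h)
    · exact hfS h
    · exact hH.notMem_of_mem hf h.1
  have hone : compCount H (S ∪ isolatedVerts H V₂ S)ᶜ = 1 := by
    refine compCount_eq_one hfY fun w hw => ?_
    have hc := hH.connIn_leaf hadj hS hSV hf hl (fun h => hw (Or.inl h)) fun h => hw (Or.inr h)
    refine (hc.induct (fun z => z ∈ (S ∪ isolatedVerts H V₂ S)ᶜ ∧
      ConnIn H (S ∪ isolatedVerts H V₂ S)ᶜ f z) ?_ ⟨hfY, ConnIn.refl _⟩).2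
    rintro a ha b hb' hab ⟨h1, h2⟩
    have h3 : b ∈ (S ∪ isolatedVerts H V₂ S)ᶜ := by
      rintro (h | h)
      · exact hb' h
      · exact ha (h.2 a hab.symm)
    exact ⟨h3, h2.trans (ConnIn.of_adj h1 h3 hab)⟩
  omega

end IsBalancedUnmixed

/-! ### Cut sets and components of the semicone -/

section

variable {V : Type*} {H : SimpleGraph V} {V₁ V₂ S : Set V} {U : Set (V ⊕ Fin 2)} {a b x y : V}

lemma semicone_adj_inl_inl : (semicone H V₁).Adj (Sum.inl a) (Sum.inl b) ↔ H.Adj a b := Iff.rfl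

lemma semicone_adj_inl_apex : (semicone H V₁).Adj (Sum.inl a) (Sum.inr 0) ↔ a ∈ V₁ :=
  ⟨fun h => h.1, fun h => ⟨h, rfl⟩⟩

lemma semicone_not_adj_inl_leaf : ¬ (semicone H V₁).Adj (Sum.inl a) (Sum.inr 1) :=
  fun h => one_ne_zero h.2

lemma semicone_adj_apex_leaf : (semicone H V₁).Adj (Sum.inr 0) (Sum.inr 1) :=
  show (0 : Fin 2) ≠ 1 from zero_ne_one

lemma eq_apex_of_adj_leaf {z : V ⊕ Fin 2} (h : (semicone H V₁).Adj (Sum.inr 1) z) :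
    z = Sum.inr 0 := by
  rcases z with z | i
  · exact absurd h.symm semicone_not_adj_inl_leaf
  · fin_cases i
    · rfl
    · exact absurd h (SimpleGraph.irrefl _)

lemma semicone_connected (hH : H.Connected) (hV : V₁.Nonempty) : (semicone H V₁).Connected := by
  obtain ⟨c, hc⟩ := hV
  let φ : H →g semicone H V₁ := ⟨Sum.inl, fun h => h⟩
  have h0 : ∀ z, (semicone H V₁).Reachable (Sum.inr 0) z := by
    have h1 : ∀ a : V, (semicone H V₁).Reachable (Sum.inr 0) (Sum.inl a) := fun a =>
      (SimpleGraph.Adj.reachable (semicone_adj_inl_apex.2 hc).symm).trans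
        ((hH.preconnected c a).map φ)
    rintro (a | i)
    · exact h1 a
    · fin_cases i
      · exact SimpleGraph.Reachable.refl _
      · exact semicone_adj_apex_leaf.reachable
  have : Nonempty (V ⊕ Fin 2) := ⟨Sum.inr 0⟩
  exact ⟨fun u w => (h0 u).symm.trans (h0 w)⟩

/-- Away from the apex, walks of the semicone are walks of the original graph. -/
lemma connIn_semicone_iff {D : Set (V ⊕ Fin 2)} (hD : Sum.inr 0 ∉ D) {z : V ⊕ Fin 2} :
    ConnIn (semicone H V₁) D (Sum.inl a) z ↔
      ∃ c, z = Sum.inl c ∧ ConnIn H (Sum.inl ⁻¹' D) a c := by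
  constructor
  · intro h
    refine h.induct (fun z => ∃ c, z = Sum.inl c ∧ ConnIn H (Sum.inl ⁻¹' D) a c) ?_
      ⟨a, rfl, ConnIn.refl _⟩
    rintro _ hcD (d | i) hd hcd ⟨c, rfl, hac⟩
    · exact ⟨d, rfl, hac.trans (ConnIn.of_adj hcD hd hcd)⟩
    · exact absurd (hcd.2 ▸ hd) hD
  · rintro ⟨c, rfl, hac⟩
    exact hac.induct (fun d => ConnIn (semicone H V₁) D (Sum.inl a) (Sum.inl d))
      (fun d hd e he hde h => h.trans (ConnIn.of_adj hd he hde)) (ConnIn.refl _)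

lemma leaf_notMem_of_mem_cutSets [Finite V] (hU : U ∈ cutSets (semicone H V₁)) :
    Sum.inr 1 ∉ U := by
  intro h
  obtain ⟨u, _, w, _, hu, hw, hn⟩ := mem_cutSets_iff.1 hU _ h
  rw [eq_apex_of_adj_leaf hu, eq_apex_of_adj_leaf hw] at hn
  exact hn (ConnIn.refl _)

lemma eq_image_union_apex (h0 : Sum.inr 0 ∈ U) (h1 : Sum.inr 1 ∉ U) :
    U = Sum.inl '' (Sum.inl ⁻¹' U) ∪ {Sum.inr 0} := by
  ext z
  rcases z with z | i
  · simp
  · fin_cases i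
    · simpa using h0
    · simpa using h1

lemma eq_image_of_notMem (h0 : Sum.inr 0 ∉ U) (h1 : Sum.inr 1 ∉ U) :
    U = Sum.inl '' (Sum.inl ⁻¹' U) := by
  ext z
  rcases z with z | i
  · simp
  · fin_cases i
    · simpa using h0
    · simpa using h1

lemma preimage_compl_image_union : (Sum.inl ⁻¹' (Sum.inl '' S ∪ {Sum.inr (0 : Fin 2)})ᶜ : Set V) =
    Sᶜ := by
  ext z
  simp

/-- With the apex removed, the rest is H − S plus the isolated new leaf. The apex itself separates
exactly when it still has a neighbour in V₁ besides that leaf. -/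
lemma image_union_apex_mem_cutSets_iff [Finite V] :
    Sum.inl '' S ∪ {Sum.inr 0} ∈ cutSets (semicone H V₁) ↔ S ∈ cutSets H ∧ ¬ V₁ ⊆ S := by
  have h0 : Sum.inr 0 ∉ (Sum.inl '' S ∪ {Sum.inr 0} : Set (V ⊕ Fin 2))ᶜ := by simp
  have hmem : ∀ a, Sum.inl a ∈ (Sum.inl '' S ∪ {Sum.inr 0} : Set (V ⊕ Fin 2))ᶜ ↔ a ∈ Sᶜ := by
    simp
  have h1 : Sum.inr 1 ∈ (Sum.inl '' S ∪ {Sum.inr 0} : Set (V ⊕ Fin 2))ᶜ := by simp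
  have hconn : ∀ a b,
      ConnIn (semicone H V₁) (Sum.inl '' S ∪ {Sum.inr 0})ᶜ (Sum.inl a) (Sum.inl b) ↔
      ConnIn H Sᶜ a b := by
    intro a b
    rw [connIn_semicone_iff h0, preimage_compl_image_union]
    exact ⟨fun ⟨c, hc, h⟩ => Sum.inl_injective hc ▸ h, fun h => ⟨b, rfl, h⟩⟩
  have hjoin : ∀ x, JoinsIn (semicone H V₁) (Sum.inl '' S ∪ {Sum.inr 0})ᶜ (Sum.inl x) ↔
      JoinsIn H Sᶜ x := by
    intro x
    constructor
    · rintro ⟨u, hu, w, hw, hxu, hxw, hn⟩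
      have hinl : ∀ z ∈ (Sum.inl '' S ∪ {Sum.inr 0} : Set (V ⊕ Fin 2))ᶜ,
          (semicone H V₁).Adj (Sum.inl x) z → ∃ c, z = Sum.inl c := by
        rintro (c | i) hz hxz
        · exact ⟨c, rfl⟩
        · exact absurd (hxz.2 ▸ hz) h0
      obtain ⟨c, rfl⟩ := hinl u hu hxu
      obtain ⟨d, rfl⟩ := hinl w hw hxw
      exact ⟨c, (hmem c).1 hu, d, (hmem d).1 hw, hxu, hxw, fun h => hn ((hconn c d).2 h)⟩
    · rintro ⟨c, hc, d, hd, hxc, hxd, hn⟩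
      exact ⟨_, (hmem c).2 hc, _, (hmem d).2 hd, hxc, hxd, fun h => hn ((hconn c d).1 h)⟩
  rw [mem_cutSets_iff, mem_cutSets_iff]
  constructor
  · intro h
    refine ⟨fun x hx => (hjoin x).1 (h _ (Or.inl ⟨x, hx, rfl⟩)), fun hV => ?_⟩
    obtain ⟨u, hu, w, hw, hvu, hvw, hn⟩ := h _ (Or.inr rfl)
    have hleaf : ∀ z ∈ (Sum.inl '' S ∪ {Sum.inr 0} : Set (V ⊕ Fin 2))ᶜ,
        (semicone H V₁).Adj (Sum.inr 0) z → z = Sum.inr 1 := by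
      rintro (c | i) hz hvz
      · exact absurd (hV hvz.1) ((hmem c).1 hz)
      · fin_cases i
        · exact absurd hz h0
        · rfl
    rw [hleaf u hu hvu, hleaf w hw hvw] at hn
    exact hn (ConnIn.refl _)
  · rintro ⟨h, hV⟩ z (⟨x, hx, rfl⟩ | rfl)
    · exact (hjoin x).2 (h x hx)
    · obtain ⟨c, hc, hcS⟩ := Set.not_subset.1 hV
      refine ⟨Sum.inl c, (hmem c).2 hcS, Sum.inr 1, h1, (semicone_adj_inl_apex.2 hc).symm,
        semicone_adj_apex_leaf, fun hconn => ?_⟩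
      obtain ⟨d, hd, _⟩ := (connIn_semicone_iff h0).1 hconn
      cases hd

lemma compCount_semicone_image (A : Set V) :
    compCount (semicone H V₁) (Sum.inl '' A) = compCount H A := by
  have hpre : (Sum.inl ⁻¹' (Sum.inl '' A : Set (V ⊕ Fin 2)) : Set V) = A :=
    Set.preimage_image_eq _ Sum.inl_injective
  rw [compCount_eq_ncard_image (Sum.map (compRep H A) id), compCount_eq_ncard_compRep,
    show Sum.map (compRep H A) id '' ((Sum.inl : V → V ⊕ Fin 2) '' A) =
      Sum.inl '' (compRep H A '' A) by rw [Set.image_image, Set.image_image]; rfl,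
    Set.ncard_image_of_injective _ Sum.inl_injective]
  rintro _ ⟨a, _, rfl⟩ _ ⟨b, _, rfl⟩
  rw [connIn_semicone_iff (by simp), hpre, Sum.map_inl, Sum.map_inl, Sum.inl_injective.eq_iff,
    compRep_eq_iff]
  exact ⟨fun h => ⟨b, rfl, h⟩, fun ⟨c, hc, h⟩ => Sum.inl_injective hc ▸ h⟩

lemma numComp_image_union_apex [Finite V] :
    numComp (semicone H V₁) (Sum.inl '' S ∪ {Sum.inr 0}) = numComp H S + 1 := by
  have hc : (Sum.inl '' S ∪ {Sum.inr 0} : Set (V ⊕ Fin 2))ᶜ = Sum.inl '' Sᶜ ∪ {Sum.inr 1} := by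
    ext z
    rcases z with z | i
    · simp
    · fin_cases i <;> simp
  rw [numComp_eq_compCount, numComp_eq_compCount, hc, compCount_union, compCount_semicone_image,
    compCount_of_indep (A := {Sum.inr 1}), Set.ncard_singleton]
  · rintro _ rfl _ rfl
    exact SimpleGraph.irrefl _
  · simp
  · rintro _ ⟨a, _, rfl⟩ _ rfl
    exact semicone_not_adj_inl_leaf

lemma ncard_image_union_apex [Finite V] :
    (Sum.inl '' S ∪ {Sum.inr 0} : Set (V ⊕ Fin 2)).ncard = S.ncard + 1 := by
  rw [Set.ncard_union_eq, Set.ncard_image_of_injective _ Sum.inl_injective, Set.ncard_singleton]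
  simp

lemma connIn_apex {D : Set (V ⊕ Fin 2)} (h0 : Sum.inr 0 ∈ D) (ha : Sum.inl a ∈ D) (haV : a ∈ V₁) :
    ConnIn (semicone H V₁) D (Sum.inr 0) (Sum.inl a) :=
  ConnIn.of_adj h0 ha (semicone_adj_inl_apex.2 haV).symm

lemma connIn_apex_of_notMem_isolatedVerts (hb : H.IsBipartiteWith V₁ V₂) (hy : y ∈ V₂)
    (hyY : y ∉ isolatedVerts H V₂ S) {D : Set (V ⊕ Fin 2)}
    (h0 : Sum.inr 0 ∈ D) (hyD : Sum.inl y ∈ D)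
    (hD : ∀ a ∈ V₁, a ∉ S → Sum.inl a ∈ D) :
    ConnIn (semicone H V₁) D (Sum.inr 0) (Sum.inl y) := by
  have : ∃ x, H.Adj y x ∧ x ∉ S := by
    by_contra! h
    exact hyY ⟨hy, h⟩
  obtain ⟨x, hyx, hx⟩ := this
  have hxV := mem_right_of_adj hb.symm hy hyx
  have hxD := hD x hxV hx
  exact (connIn_apex h0 hxD hxV).trans (ConnIn.of_adj hxD hyD (semicone_adj_inl_inl.2 hyx.symm))

/-- While the apex remains, every surviving vertex of V₁, and every surviving vertex of V₂ with a
neighbour outside S, is connected to it. A removed vertex can therefore join two components only if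
it lies in V₁ and has an isolated neighbour. -/
lemma image_mem_cutSets_iff [Finite V] (hb : H.IsBipartiteWith V₁ V₂)
    (hcover : V₁ ∪ V₂ = Set.univ) :
    Sum.inl '' S ∈ cutSets (semicone H V₁) ↔ S ⊆ V₁ ∧ IsolatesNeighbors H S := by
  have h0 : Sum.inr 0 ∈ (Sum.inl '' S : Set (V ⊕ Fin 2))ᶜ := by simp
  have hmem : ∀ a, Sum.inl a ∈ (Sum.inl '' S : Set (V ⊕ Fin 2))ᶜ ↔ a ∉ S := by simp
  rw [mem_cutSets_iff]
  constructor
  · intro h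
    have hSV : S ⊆ V₁ := by
      intro x hx
      by_contra hxV
      have hxV₂ : x ∈ V₂ := by
        have : x ∈ V₁ ∪ V₂ := hcover ▸ Set.mem_univ x
        exact this.resolve_left hxV
      obtain ⟨u, hu, w, hw, hxu, hxw, hn⟩ := h _ ⟨x, hx, rfl⟩
      have key : ∀ z ∈ (Sum.inl '' S : Set (V ⊕ Fin 2))ᶜ, (semicone H V₁).Adj (Sum.inl x) z →
          ConnIn (semicone H V₁) (Sum.inl '' S)ᶜ (Sum.inr 0) z := by
        rintro (c | i) hz hxz
        · exact connIn_apex h0 hz (mem_right_of_adj hb.symm hxV₂ hxz)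
        · exact absurd hxz.1 hxV
      exact hn ((key u hu hxu).symm.trans (key w hw hxw))
    refine ⟨hSV, fun x hx => ?_⟩
    by_contra hiso
    obtain ⟨u, hu, w, hw, hxu, hxw, hn⟩ := h _ ⟨x, hx, rfl⟩
    have key : ∀ z ∈ (Sum.inl '' S : Set (V ⊕ Fin 2))ᶜ, (semicone H V₁).Adj (Sum.inl x) z →
        ConnIn (semicone H V₁) (Sum.inl '' S)ᶜ (Sum.inr 0) z := by
      rintro (c | i) hz hxz
      · refine connIn_apex_of_notMem_isolatedVerts hb (mem_right_of_adj hb (hSV hx) hxz)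
          (fun hc => hiso ⟨c, hxz, hc.2⟩) h0 hz fun a _ haS => (hmem a).2 haS
      · rw [hxz.2]
        exact ConnIn.refl _
    exact hn ((key u hu hxu).symm.trans (key w hw hxw))
  · rintro ⟨hSV, hiso⟩ _ ⟨x, hx, rfl⟩
    obtain ⟨y, hxy, hy⟩ := hiso x hx
    have hyV := mem_right_of_adj hb (hSV hx) hxy
    have hnV : y ∉ V₁ := fun h => Set.disjoint_left.1 hb.disjoint h hyV
    refine ⟨Sum.inl y, (hmem y).2 fun h => hnV (hSV h), Sum.inr 0, h0, hxy,
      semicone_adj_inl_apex.2 (hSV hx), not_connIn_of_pendant (by simp)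
      (fun h => hnV (semicone_adj_inl_apex.1 h)) ?_⟩
    rintro (c | i) hz hyz
    · exact absurd (hy c hyz) ((hmem c).1 hz)
    · exact absurd hyz.1 hnV

lemma numComp_image [Finite V] (hb : H.IsBipartiteWith V₁ V₂) (hcover : V₁ ∪ V₂ = Set.univ)
    (hSV : S ⊆ V₁) :
    numComp (semicone H V₁) (Sum.inl '' S) = (isolatedVerts H V₂ S).ncard + 1 := by
  have hYS : ∀ y ∈ isolatedVerts H V₂ S, y ∉ S :=
    fun y hy h => Set.disjoint_left.1 hb.disjoint (hSV h) hy.1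
  have hnV : ∀ y ∈ isolatedVerts H V₂ S, y ∉ V₁ :=
    fun y hy h => Set.disjoint_left.1 hb.disjoint h hy.1
  set C : Set (V ⊕ Fin 2) := (Sum.inl '' (S ∪ isolatedVerts H V₂ S))ᶜ with hC
  have hmem : ∀ a, Sum.inl a ∈ C ↔ a ∉ S ∧ a ∉ isolatedVerts H V₂ S := by simp [hC]
  have h0 : Sum.inr 0 ∈ C := by simp [hC]
  have hsplit : (Sum.inl '' S : Set (V ⊕ Fin 2))ᶜ = Sum.inl '' isolatedVerts H V₂ S ∪ C := by
    ext z
    rcases z with z | i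
    · have := hYS z
      rw [Set.mem_union, hmem, Set.mem_compl_iff, Sum.inl_injective.mem_set_image,
        Sum.inl_injective.mem_set_image]
      tauto
    · simp [hC]
  have hone : compCount (semicone H V₁) C = 1 := by
    refine compCount_eq_one h0 ?_
    have hD : ∀ a ∈ V₁, a ∉ S → Sum.inl a ∈ C := fun a ha haS => (hmem a).2 ⟨haS, fun h =>
      hnV a h ha⟩
    rintro (c | i) hw
    · have hcC := (hmem c).1 hw
      have hc : c ∈ V₁ ∪ V₂ := hcover ▸ Set.mem_univ c
      rcases hc with hc | hc
      · exact connIn_apex h0 hw hc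
      · exact connIn_apex_of_notMem_isolatedVerts hb hc hcC.2 h0 hw hD
    · fin_cases i
      · exact ConnIn.refl _
      · exact ConnIn.of_adj h0 hw semicone_adj_apex_leaf
  rw [numComp_eq_compCount, hsplit, compCount_union, hone, compCount_semicone_image,
    compCount_of_indep fun a ha b hb' => not_adj_of_mem hb ha.1 hb'.1]
  · rw [Set.disjoint_left]
    rintro _ ⟨a, ha, rfl⟩ h
    exact ((hmem a).1 h).2 ha
  · rintro _ ⟨a, ha, rfl⟩ (c | i) hc hac
    · exact ((hmem c).1 hc).1 (ha.2 c hac)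
    · exact hnV a ha hac.1

lemma isLeafVertex_of_semicone [Finite V] (hx : x ∈ V₁)
    (h : ((semicone H V₁).neighborSet (Sum.inl x)).ncard = 2) : IsLeafVertex H x := by
  have heq : (semicone H V₁).neighborSet (Sum.inl x) =
      insert (Sum.inr 0) (Sum.inl '' H.neighborSet x) := by
    ext z
    rcases z with z | i
    · simp [semicone_adj_inl_inl]
    · fin_cases i
      · simp [semicone_adj_inl_apex, hx]
      · simp [semicone_not_adj_inl_leaf]
  rw [heq, Set.ncard_insert_of_notMem (by simp),
    Set.ncard_image_of_injective _ Sum.inl_injective] at h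
  exact Nat.succ_injective h

/-- The cut sets of the semicone. -/
lemma IsBalancedUnmixed.mem_cutSets_semicone_iff [Finite V] (hH : IsBalancedUnmixed H V₁ V₂)
    (hadj : LeafNeighborsAdjacent H) : U ∈ cutSets (semicone H V₁) ↔
      (U = ∅ ∨ U = Sum.inl '' V₁) ∨ (∃ S ∈ cutSets H, U = Sum.inl '' S ∪ {Sum.inr 0}) ∨
        ∃ T ∈ cutSets H, T ⊆ V₁ ∧ U = Sum.inl '' T := by
  obtain ⟨f, hf, hl, -⟩ := hH.exists_unique_leaf
  constructor
  · intro hU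
    have h1 := leaf_notMem_of_mem_cutSets hU
    by_cases h0 : Sum.inr 0 ∈ U
    · have heq := eq_image_union_apex h0 h1
      rw [heq, image_union_apex_mem_cutSets_iff] at hU
      exact Or.inr (Or.inl ⟨_, hU.1, heq⟩)
    · have heq := eq_image_of_notMem h0 h1
      rw [heq, image_mem_cutSets_iff hH.bipartite hH.cover] at hU
      -- The leaf of V₁ decides between the two kinds of cut set avoiding the apex: V₁ itself, or a
      -- cut set of H.
      by_cases hfU : f ∈ Sum.inl ⁻¹' U
      · rw [hH.eq_left_of_leaf_mem hadj hU.2 hU.1 hl hfU] at heq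
        exact Or.inl (Or.inr heq)
      · exact Or.inr (Or.inr ⟨_, hH.mem_cutSets_of_leaf_notMem hU.2 hU.1 hf hl hfU, hU.1, heq⟩)
  · rintro ((rfl | rfl) | ⟨S, hS, rfl⟩ | ⟨T, hT, hTV, rfl⟩)
    · exact empty_mem_cutSets
    · exact (image_mem_cutSets_iff hH.bipartite hH.cover).2 ⟨subset_rfl, hH.isolatesNeighbors_left⟩
    · exact image_union_apex_mem_cutSets_iff.2
        ⟨hS, fun h => hl.notMem_of_mem_cutSets hS (h hf)⟩
    · exact (image_mem_cutSets_iff hH.bipartite hH.cover).2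
        ⟨hTV, (hH.isolatesNeighbors_of_mem_cutSets hadj hT hTV).1⟩

lemma IsBalancedUnmixed.numComp_semicone [Finite V] (hH : IsBalancedUnmixed H V₁ V₂)
    (hadj : LeafNeighborsAdjacent H) (hU : U ∈ cutSets (semicone H V₁)) :
    numComp (semicone H V₁) U = U.ncard + 1 := by
  have himg : ∀ T ⊆ V₁, (isolatedVerts H V₂ T).ncard = T.ncard →
      numComp (semicone H V₁) (Sum.inl '' T) = (Sum.inl '' T : Set (V ⊕ Fin 2)).ncard + 1 := by
    intro T hT h
    rw [numComp_image hH.bipartite hH.cover hT, h,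
      Set.ncard_image_of_injective _ Sum.inl_injective]
  rcases (hH.mem_cutSets_semicone_iff hadj).1 hU with
    (rfl | rfl) | ⟨S, hS, rfl⟩ | ⟨T, hT, hTV, rfl⟩
  · have := himg ∅ (Set.empty_subset _)
      (hH.isolatesNeighbors_of_mem_cutSets hadj empty_mem_cutSets (Set.empty_subset _)).2
    rwa [Set.image_empty] at this
  · exact himg V₁ subset_rfl (by rw [hH.isolatedVerts_left, hH.card])
  · rw [numComp_image_union_apex, ncard_image_union_apex, hH.unmixed S hS]
  · exact himg T hTV (hH.isolatesNeighbors_of_mem_cutSets hadj hT hTV).2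

end

theorem proposition2p6 {V : Type*} [Finite V] (K : Type*) [Field K]
    (H : SimpleGraph V) (hconn : H.Connected) (V₁ V₂ : Set V)
    (hbip : H.IsBipartiteWith V₁ V₂) (hcover : V₁ ∪ V₂ = Set.univ)
    (hcard : V₁.ncard = V₂.ncard) :
    (IsUnmixedIdeal (binomialEdgeIdeal K H) → LeafNeighborsAdjacent H →
      IsUnmixedIdeal (binomialEdgeIdeal K (semicone H V₁)) ∧
      cutSets (semicone H V₁) =
        {∅, Sum.inl '' V₁} ∪
        {U | ∃ S ∈ cutSets H, U = Sum.inl '' S ∪ {Sum.inr 0}} ∪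
        {U | ∃ T ∈ cutSets H, T ⊆ V₁ ∧ U = Sum.inl '' T}) ∧
    ((∃ w ∈ V₁, ((semicone H V₁).neighborSet (Sum.inl w)).ncard = 2) →
      IsUnmixedIdeal (binomialEdgeIdeal K (semicone H V₁)) →
      IsUnmixedIdeal (binomialEdgeIdeal K H) ∧ LeafNeighborsAdjacent H) := by
  constructor
  · intro hun hadj
    have hH : IsBalancedUnmixed H V₁ V₂ :=
      ⟨hconn, hbip, hcover, hcard, (isUnmixedIdeal_binomialEdgeIdeal_iff hconn).1 hun⟩
    refine ⟨(isUnmixedIdeal_binomialEdgeIdeal_iff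
      (semicone_connected hconn hH.left_nonempty)).2 fun U hU => hH.numComp_semicone hadj hU, ?_⟩
    ext U
    rw [hH.mem_cutSets_semicone_iff hadj, Set.union_assoc]
    rfl
  · rintro ⟨w, hw, hdeg⟩ hun
    have hwl := isLeafVertex_of_semicone hw hdeg
    have hG := (isUnmixedIdeal_binomialEdgeIdeal_iff (semicone_connected hconn ⟨w, hw⟩)).1 hun
    have hcut : ∀ S ∈ cutSets H, numComp H S = S.ncard + 1 := by
      intro S hS
      -- The leaf `w` of V₁ lies in no cut set of H, so V₁ is never contained in S.
      have := hG _ (image_union_apex_mem_cutSets_iff.2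
        ⟨hS, fun h => hwl.notMem_of_mem_cutSets hS (h hw)⟩)
      rw [numComp_image_union_apex, ncard_image_union_apex] at this
      exact Nat.succ_injective this
    refine ⟨(isUnmixedIdeal_binomialEdgeIdeal_iff hconn).2 hcut, ?_⟩
    have hH : IsBalancedUnmixed H V₁ V₂ := ⟨hconn, hbip, hcover, hcard, hcut⟩
    obtain ⟨w', _, _, hu₁⟩ := hH.exists_unique_leaf
    obtain ⟨f, _, _, hu₂⟩ := hH.symm.exists_unique_leaf
    have key : ∀ l₁ l₂ x₁ x₂ : V, l₁ ∈ V₁ → l₂ ∈ V₂ → IsLeafVertex H l₁ →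
        H.Adj l₁ x₁ → H.Adj l₂ x₂ → H.Adj x₁ x₂ := by
      intro l₁ l₂ x₁ x₂ h₁ h₂ hl₁ h1 h2
      have hx₁ := mem_right_of_adj hbip h₁ h1
      -- N(x₁) isolates x₁ and contains the leaf l₁. Unmixedness of the semicone yields as many
      -- isolated vertices as |N(x₁)|, which forces N(x₁) = V₁ and so x₂ ∈ N(x₁).
      have hSV : H.neighborSet x₁ ⊆ V₁ := fun z hz => mem_right_of_adj hbip.symm hx₁ hz
      have hiso : IsolatesNeighbors H (H.neighborSet x₁) :=
        fun z hz => ⟨x₁, SimpleGraph.Adj.symm hz, fun _ h => h⟩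
      have hc := hG _ ((image_mem_cutSets_iff hbip hcover).2 ⟨hSV, hiso⟩)
      rw [numComp_image hbip hcover hSV, Set.ncard_image_of_injective _ Sum.inl_injective] at hc
      have heq := hH.eq_left_of_ncard_le hiso hSV hl₁ (show l₁ ∈ H.neighborSet x₁ from h1.symm)
        (by omega)
      have hx₂ : x₂ ∈ H.neighborSet x₁ := heq ▸ mem_right_of_adj hbip.symm h₂ h2
      exact hx₂
    intro l₁ l₂ x₁ x₂ hl₁ hl₂ hne h1 h2
    rcases hH.mem_or l₁ with h₁ | h₁ <;> rcases hH.mem_or l₂ with h₂ | h₂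
    · exact absurd ((hu₁ l₁ h₁ hl₁).trans (hu₁ l₂ h₂ hl₂).symm) hne
    · exact key l₁ l₂ x₁ x₂ h₁ h₂ hl₁ h1 h2
    · exact (key l₂ l₁ x₂ x₁ h₂ h₁ hl₂ h2 h1).symm
    · exact absurd ((hu₂ l₁ h₁ hl₁).trans (hu₂ l₂ h₂ hl₂).symm) hne
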